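/- Let $n\ge 0$ and $\ell\ge 0$ be integers. Let $B_n$ be the braid group on $n$ strands, with Artin generators $\sigma_1,\dots,\sigma_{n-1}$, and let $\rho\colon B_n\to \mathrm{GL}_n(\mathbb{Z})$ be the integral Burau representation, that is, the unreduced Burau representation at $t=-1$: $\rho(\sigma_i)$ is the identity matrix except for the diagonal block $\begin{pmatrix}2&-1\\1&0\end{pmatrix}$ in the rows and columns $i,i+1$. Let $B_n[\ell]=\{b\in B_n\mid \rho(b)\equiv I_n \bmod \ell\}$. Equip $\mathbb{Z}^n$ with the alternating bilinear form given by $\langle e_i,e_j\rangle=(-1)^{i+j+1}$ for $i<j$, and put $v_n=e_1+e_2+\dots+e_n$ and $w_n=e_1-e_2+\dots+(-1)^{n-1}e_n$. Define $$\Gamma_{n-1}=\{A\in \mathrm{GL}_n(\mathbb{Z})\mid \langle Av,Aw\rangle=\langle v,w\rangle \text{ for all } v,w\in\mathbb{Z}^n,\ Av_n=v_n,\ w_n^TA=w_n^T\},$$ $$\Gamma_{n-1}[\ell]=\{A\in\Gamma_{n-1}\mid A\equiv I_n \bmod \ell\}.$$ The image of $\rho$ lies in $\Gamma_{n-1}$,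 and the image $\rho(B_n[\ell])$ in $\mathrm{GL}_n(\mathbb{Z})$ is as follows. 1. If $\ell$ is even, or $n=2$, or $n=3$, then $\rho(B_n[\ell])=\Gamma_{n-1}[\ell]$. 2. If $n\ge 4$ and $\ell$ is odd, then there is an injective homomorphism $\iota\colon S_n\hookrightarrow \Gamma_{n-1}[\ell]/\Gamma_{n-1}[2\ell]$ whose composition with the natural map $\Gamma_{n-1}[\ell]/\Gamma_{n-1}[2\ell]\to\Gamma_{n-1}/\Gamma_{n-1}[2]$ sends the permutation of the strands induced by $b$ to the class of $\rho(b)$, for every $b\in B_n$; and $\rho(B_n[\ell])$ is the preimage of $\iota(S_n)$ under the quotient map $\Gamma_{n-1}[\ell]\to\Gamma_{n-1}[\ell]/\Gamma_{n-1}[2\ell]$. (Congruence modulo $0$ means equality.) -/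

import Mathlib

/-- The relators of Artin's presentation, on generators `σ_0, …, σ_{n-2}`:
`σ_i σ_j σ_i = σ_j σ_i σ_j` for `j = i + 1` and `σ_i σ_j = σ_j σ_i` for `j ≥ i + 2`. -/
inductive ArtinRelator (n : ℕ) : FreeGroup (Fin (n - 1)) → Prop
  | braid (i j : Fin (n - 1)) (h : (i : ℕ) + 1 = j) :
      ArtinRelator n (FreeGroup.of i * FreeGroup.of j * FreeGroup.of i *
        (FreeGroup.of j * FreeGroup.of i * FreeGroup.of j)⁻¹)
  | comm (i j : Fin (n - 1)) (h : (i : ℕ) + 2 ≤ j) :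
      ArtinRelator n (FreeGroup.of i * FreeGroup.of j * (FreeGroup.of j * FreeGroup.of i)⁻¹)

/-- The braid group `B_n` on `n` strands. -/
abbrev BraidGroup (n : ℕ) : Type := PresentedGroup {r | ArtinRelator n r}

namespace BraidGroup

/-- The Artin generator `σ_i`, the half twist on the strands `i` and `i + 1` (from 0). -/
def σ {n : ℕ} (i : Fin (n - 1)) : BraidGroup n := PresentedGroup.of i

/-- A homomorphism out of `B_n` from elements that satisfy the braid relations. -/
def lift {n : ℕ} {G : Type*} [Group G] (f : Fin (n - 1) → G)
    (hb : ∀ i j : Fin (n - 1), (i : ℕ) + 1 = j → f i * f j * f i = f j * f i * f j)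
    (hc : ∀ i j : Fin (n - 1), (i : ℕ) + 2 ≤ j → f i * f j = f j * f i) :
    BraidGroup n →* G :=
  PresentedGroup.toGroup (f := f) (rels := {r | ArtinRelator n r}) (by
    rintro r (⟨i, j, h⟩ | ⟨i, j, h⟩)
    · simp only [map_mul, map_inv, FreeGroup.lift_apply_of]
      rw [hb i j h, mul_inv_cancel]
    · simp only [map_mul, map_inv, FreeGroup.lift_apply_of]
      rw [hc i j h, mul_inv_cancel])

theorem lift_σ {n : ℕ} {G : Type*} [Group G] (f : Fin (n - 1) → G)
    (hb : ∀ i j : Fin (n - 1), (i : ℕ) + 1 = j → f i * f j * f i = f j * f i * f j)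
    (hc : ∀ i j : Fin (n - 1), (i : ℕ) + 2 ≤ j → f i * f j = f j * f i) (i : Fin (n - 1)) :
    lift f hb hc (σ i) = f i :=
  PresentedGroup.toGroup.of _

/-- The strand `i` of the generator `σ_i`. -/
def strand {n : ℕ} (i : Fin (n - 1)) : Fin n := ⟨i, by omega⟩

/-- The strand `i + 1` of the generator `σ_i`. -/
def strandSucc {n : ℕ} (i : Fin (n - 1)) : Fin n := ⟨i + 1, by omega⟩

/-- The homomorphism `B_n → S_n` that sends a braid to its permutation of the strands,
`σ_i ↦ (i  i+1)`. -/
def perm (n : ℕ) : BraidGroup n →* Equiv.Perm (Fin n) :=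
  lift (fun i => Equiv.swap (strand i) (strandSucc i))
    (by
      intro i j h
      ext x
      simp only [Equiv.Perm.mul_apply, Equiv.swap_apply_def, strand, strandSucc, Fin.ext_iff]
      grind)
    (by
      intro i j h
      ext x
      simp only [Equiv.Perm.mul_apply, Equiv.swap_apply_def, strand, strandSucc, Fin.ext_iff]
      grind)

/-- The matrix of `σ_i` in the unreduced Burau representation with parameter `t`: the identity
except for the diagonal block `(1 - t, t; 1, 0)` in the rows and columns `i`, `i + 1`. -/
def burauMatrix {R : Type*} [CommRing R] {n : ℕ} (t : R) (i : Fin (n - 1)) :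
    Matrix (Fin n) (Fin n) R :=
  Matrix.of fun a b =>
    if a = strand i then
      if b = strand i then 1 - t else if b = strandSucc i then t else 0
    else if a = strandSucc i then
      if b = strand i then 1 else 0
    else if a = b then 1 else 0

/-- The inverse of `burauMatrix`, with diagonal block `(0, 1; t⁻¹, 1 - t⁻¹)`; here `s = t⁻¹`. -/
def burauMatrixInv {R : Type*} [CommRing R] {n : ℕ} (s : R) (i : Fin (n - 1)) :
    Matrix (Fin n) (Fin n) R :=
  Matrix.of fun a b =>
    if a = strand i then
      if b = strandSucc i then 1 else 0
    else if a = strandSucc i then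
      if b = strand i then s else if b = strandSucc i then 1 - s else 0
    else if a = b then 1 else 0

theorem strand_ne {n : ℕ} (i : Fin (n - 1)) : strand i ≠ strandSucc i := by
  simp [strand, strandSucc]

theorem burauMatrix_mulVec {R : Type*} [CommRing R] {n : ℕ} (t : R) (i : Fin (n - 1))
    (x : Fin n → R) (a : Fin n) :
    (burauMatrix t i).mulVec x a =
      if a = strand i then (1 - t) * x (strand i) + t * x (strandSucc i)
      else if a = strandSucc i then x (strand i) else x a := by
  have h := strand_ne i
  simp only [Matrix.mulVec, dotProduct, burauMatrix, Matrix.of_apply]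
  split_ifs with h1 h2
  · rw [Finset.sum_eq_add (strand i) (strandSucc i) h] <;> simp_all [h.symm]
  · rw [Finset.sum_eq_single (strand i)] <;> simp_all
  · simp

theorem burauMatrixInv_mulVec {R : Type*} [CommRing R] {n : ℕ} (s : R) (i : Fin (n - 1))
    (x : Fin n → R) (a : Fin n) :
    (burauMatrixInv s i).mulVec x a =
      if a = strand i then x (strandSucc i)
      else if a = strandSucc i then s * x (strand i) + (1 - s) * x (strandSucc i) else x a := by
  have h := strand_ne i
  simp only [Matrix.mulVec, dotProduct, burauMatrixInv, Matrix.of_apply]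
  split_ifs with h1 h2
  · rw [Finset.sum_eq_single (strandSucc i)] <;> simp_all
  · rw [Finset.sum_eq_add (strand i) (strandSucc i) h] <;> simp_all
  · simp

/-- The matrix of `σ_i` as an element of `GL_n(R)`. -/
def burauGL {R : Type*} [CommRing R] {n : ℕ} (t : Rˣ) (i : Fin (n - 1)) : GL (Fin n) R where
  val := burauMatrix (t : R) i
  inv := burauMatrixInv ((t⁻¹ : Rˣ) : R) i
  val_inv := by
    apply Matrix.mulVec_injective
    funext x
    ext a
    have h := strand_ne i
    have ht : (t : R) * ((t⁻¹ : Rˣ) : R) = 1 := t.mul_inv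
    rw [← Matrix.mulVec_mulVec, Matrix.one_mulVec]
    simp only [burauMatrix_mulVec, burauMatrixInv_mulVec]
    grind
  inv_val := by
    apply Matrix.mulVec_injective
    funext x
    ext a
    have h := strand_ne i
    have ht : (t : R) * ((t⁻¹ : Rˣ) : R) = 1 := t.mul_inv
    rw [← Matrix.mulVec_mulVec, Matrix.one_mulVec]
    simp only [burauMatrix_mulVec, burauMatrixInv_mulVec]
    grind

/-- The unreduced Burau representation `B_n → GL_n(R)` with an invertible parameter `t ∈ R`. -/
def burau {R : Type*} [CommRing R] (n : ℕ) (t : Rˣ) : BraidGroup n →* GL (Fin n) R :=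
  lift (burauGL t)
    (by
      intro i j h
      apply Units.ext
      apply Matrix.mulVec_injective
      funext x
      ext a
      simp only [burauGL, Units.val_mul, ← Matrix.mulVec_mulVec, burauMatrix_mulVec, strand,
        strandSucc, Fin.ext_iff]
      grind)
    (by
      intro i j h
      apply Units.ext
      apply Matrix.mulVec_injective
      funext x
      ext a
      simp only [burauGL, Units.val_mul, ← Matrix.mulVec_mulVec, burauMatrix_mulVec, strand,
        strandSucc, Fin.ext_iff]
      grind)

/-- The integral Burau representation `ρ : B_n → GL_n(ℤ)`: the Burau representation at `t = -1`. -/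
def integralBurau (n : ℕ) : BraidGroup n →* GL (Fin n) ℤ := burau n (-1 : ℤˣ)

end BraidGroup

/-- Reduction modulo `ℓ`, `GL_n(ℤ) → GL_n(ℤ/ℓℤ)`. -/
def reduceMod (n ℓ : ℕ) : GL (Fin n) ℤ →* GL (Fin n) (ZMod ℓ) :=
  Matrix.GeneralLinearGroup.map (Int.castRingHom (ZMod ℓ))

/-- The level `ℓ` congruence subgroup `B_n[ℓ]` of the braid group. -/
def braidCongruence (n ℓ : ℕ) : Subgroup (BraidGroup n) :=
  ((reduceMod n ℓ).comp (BraidGroup.integralBurau n)).ker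

/-- The alternating form on `ℤ^n` with `⟨e_i, e_j⟩ = (-1)^(i+j+1)` for `i < j`. -/
def altMatrix (n : ℕ) : Matrix (Fin n) (Fin n) ℤ :=
  Matrix.of fun i j =>
    if i < j then (-1) ^ ((i : ℕ) + j + 1) else if i = j then 0 else (-1) ^ ((i : ℕ) + j)

/-- The alternating form `⟨v, w⟩` on `ℤ^n`. -/
def altForm {n : ℕ} (v w : Fin n → ℤ) : ℤ := v ⬝ᵥ (altMatrix n).mulVec w

/-- The vector `v_n = e_1 + ⋯ + e_n`. -/
def vVec (n : ℕ) : Fin n → ℤ := fun _ => 1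

/-- The vector `w_n = e_1 - e_2 + ⋯ + (-1)^(n-1) e_n`. -/
def wVec (n : ℕ) : Fin n → ℤ := fun i => (-1) ^ (i : ℕ)

/-- The group `Γ_{n-1} ≤ GL_n(ℤ)` (note the shift of the index) of the matrices `A` that preserve
the alternating form and satisfy `A v_n = v_n` and `w_nᵀ A = w_nᵀ`. -/
def Gam (n : ℕ) : Subgroup (GL (Fin n) ℤ) where
  carrier := {A | (∀ v w, altForm (A.1.mulVec v) (A.1.mulVec w) = altForm v w) ∧
    A.1.mulVec (vVec n) = vVec n ∧ Matrix.vecMul (wVec n) A.1 = wVec n}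
  one_mem' := by simp
  mul_mem' := by
    rintro A B ⟨hA, hA', hA''⟩ ⟨hB, hB', hB''⟩
    refine ⟨fun v w => ?_, ?_, ?_⟩
    · rw [Units.val_mul, ← Matrix.mulVec_mulVec, ← Matrix.mulVec_mulVec, hA, hB]
    · rw [Units.val_mul, ← Matrix.mulVec_mulVec, hB', hA']
    · rw [Units.val_mul, ← Matrix.vecMul_vecMul, hA'', hB'']
  inv_mem' := by
    rintro A ⟨hA, hA', hA''⟩
    have h1 : A.1 * (A⁻¹).1 = 1 := A.mul_inv
    have h2 : (A⁻¹).1 * A.1 = 1 := A.inv_mul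
    refine ⟨fun v w => ?_, ?_, ?_⟩
    · rw [← hA, Matrix.mulVec_mulVec, Matrix.mulVec_mulVec, h1, Matrix.one_mulVec,
        Matrix.one_mulVec]
    · conv_lhs => rw [← hA']
      rw [Matrix.mulVec_mulVec, h2, Matrix.one_mulVec]
    · conv_lhs => rw [← hA'']
      rw [Matrix.vecMul_vecMul, h1, Matrix.vecMul_one]

/-- The level `ℓ` congruence subgroup `Γ_{n-1}[ℓ]` of `Γ_{n-1}`, as a subgroup of `GL_n(ℤ)`. -/
def GamLevel (n ℓ : ℕ) : Subgroup (GL (Fin n) ℤ) := Gam n ⊓ (reduceMod n ℓ).ker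

theorem reduceMod_ker_le {n ℓ m : ℕ} (h : ℓ ∣ m) : (reduceMod n m).ker ≤ (reduceMod n ℓ).ker := by
  have key : reduceMod n ℓ =
      (Matrix.GeneralLinearGroup.map (ZMod.castHom h (ZMod ℓ))).comp (reduceMod n m) := by
    rw [reduceMod, reduceMod, ← Matrix.GeneralLinearGroup.map_comp]
    congr 1
    exact RingHom.ext_int _ _
  intro A hA
  rw [MonoidHom.mem_ker] at hA ⊢
  rw [key, MonoidHom.comp_apply, hA, map_one]

instance GamLevel.normal (n ℓ : ℕ) : ((GamLevel n ℓ).subgroupOf (Gam n)).Normal := by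
  rw [GamLevel, Subgroup.inf_subgroupOf_left]
  infer_instance

instance GamLevel.normal_two_mul (n ℓ : ℕ) :
    ((GamLevel n (2 * ℓ)).subgroupOf (GamLevel n ℓ)).Normal where
  conj_mem := by
    intro A hA B
    rw [Subgroup.mem_subgroupOf] at hA ⊢
    have h := (GamLevel.normal n (2 * ℓ)).conj_mem ⟨A.1, A.2.1⟩ hA ⟨B.1, B.2.1⟩
    exact h

/-- The natural homomorphism `Γ_{n-1}[ℓ] / Γ_{n-1}[2ℓ] → Γ_{n-1} / Γ_{n-1}[2]` induced by the
inclusion `Γ_{n-1}[ℓ] ≤ Γ_{n-1}`. -/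
def GamLevel.toModTwo (n ℓ : ℕ) :
    GamLevel n ℓ ⧸ (GamLevel n (2 * ℓ)).subgroupOf (GamLevel n ℓ) →*
      Gam n ⧸ (GamLevel n 2).subgroupOf (Gam n) :=
  QuotientGroup.map _ _ (Subgroup.inclusion (inf_le_left : GamLevel n ℓ ≤ Gam n)) (by
    intro A hA
    exact ⟨A.2.1, reduceMod_ker_le (Dvd.intro ℓ rfl) hA.2⟩)

theorem altForm_add_left {n : ℕ} (u v w : Fin n → ℤ) :
    altForm (u + v) w = altForm u w + altForm v w := by
  simp [altForm, add_dotProduct]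

theorem altForm_add_right {n : ℕ} (u v w : Fin n → ℤ) :
    altForm u (v + w) = altForm u v + altForm u w := by
  simp [altForm, Matrix.mulVec_add, dotProduct_add]

theorem altForm_smul_left {n : ℕ} (c : ℤ) (u v : Fin n → ℤ) :
    altForm (c • u) v = c * altForm u v := by
  rw [altForm, altForm, smul_dotProduct, smul_eq_mul]

theorem altForm_smul_right {n : ℕ} (c : ℤ) (u v : Fin n → ℤ) :
    altForm u (c • v) = c * altForm u v := by
  rw [altForm, altForm, Matrix.mulVec_smul, dotProduct_smul, smul_eq_mul]

theorem altForm_swap {n : ℕ} (u v : Fin n → ℤ) : altForm u v = -altForm v u := by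
  have h : (altMatrix n).transpose = -altMatrix n := by
    ext i j
    simp only [altMatrix, Matrix.transpose_apply, Matrix.of_apply, Matrix.neg_apply]
    rcases lt_trichotomy i j with h | h | h
    · simp [h, h.not_gt, h.ne', pow_succ, add_comm]
    · simp [h]
    · simp [h, h.not_gt, h.ne', pow_succ, add_comm]
  rw [altForm, altForm, Matrix.dotProduct_mulVec, ← Matrix.mulVec_transpose, h, dotProduct_comm,
    Matrix.neg_mulVec, dotProduct_neg]

open BraidGroup in
theorem altForm_strand {n : ℕ} (i : Fin (n - 1)) (x : Fin n → ℤ) :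
    altForm x (Pi.single (strand i) 1 + Pi.single (strandSucc i) 1) =
      x (strand i) - x (strandSucc i) := by
  have h := strand_ne i
  have key : (altMatrix n).mulVec (Pi.single (strand i) 1 + Pi.single (strandSucc i) 1) =
      Pi.single (strand i) 1 - Pi.single (strandSucc i) 1 := by
    ext a
    rw [Matrix.mulVec_add, Matrix.mulVec_single_one, Matrix.mulVec_single_one]
    simp only [Pi.add_apply, Pi.sub_apply, Matrix.col_apply, altMatrix, Matrix.of_apply,
      Pi.single_apply, strand, strandSucc, Fin.ext_iff, Fin.lt_def]
    rcases lt_trichotomy (a : ℕ) (i : ℕ) with h | h | h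
    · rw [if_pos h, if_pos (by omega), if_neg (by omega), if_neg (by omega)]
      ring
    · rw [h, if_neg (by omega), if_pos rfl, if_pos (by omega), if_pos rfl, if_neg (by omega),
        show (i : ℕ) + (i + 1) + 1 = 2 * (i + 1) by ring, pow_mul]
      simp
    · rcases eq_or_ne (a : ℕ) (i + 1) with h' | h'
      · rw [h', if_neg (by omega), if_neg (by omega), if_neg (by omega), if_pos rfl,
          if_neg (by omega), if_pos rfl, show (i : ℕ) + 1 + i = 2 * i + 1 by ring, pow_succ,
          pow_mul]
        simp
      · rw [if_neg (by omega), if_neg (by omega), if_neg (by omega), if_neg (by omega),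
          if_neg (by omega), if_neg (by omega)]
        ring
  rw [altForm, key, dotProduct_sub]
  simp

open BraidGroup in
theorem burauGL_mem_Gam {n : ℕ} (i : Fin (n - 1)) : burauGL (-1 : ℤˣ) i ∈ Gam n := by
  have hne := strand_ne i
  have key : ∀ x : Fin n → ℤ, (burauGL (-1 : ℤˣ) i).1.mulVec x =
      x + (x (strand i) - x (strandSucc i)) •
        (Pi.single (strand i) 1 + Pi.single (strandSucc i) 1) := by
    intro x
    ext a
    simp only [burauGL, burauMatrix_mulVec, Pi.add_apply, Pi.smul_apply, Pi.single_apply,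
      Units.val_neg, Units.val_one, smul_eq_mul]
    grind
  refine ⟨fun x y => ?_, ?_, ?_⟩
  · rw [key, key]
    set u : Fin n → ℤ := Pi.single (strand i) 1 + Pi.single (strandSucc i) 1 with hu
    simp only [altForm_add_left, altForm_add_right, altForm_smul_left, altForm_smul_right]
    have h1 := altForm_strand i x
    have h2 := altForm_strand i y
    have h3 := altForm_swap u y
    have h4 := altForm_swap u u
    rw [← hu] at h1 h2
    have h5 : altForm u u = 0 := by omega
    rw [h5, h3, h1, h2]
    ring
  · rw [key]
    simp [vVec]
  · have h : (-1 : ℤ) ^ ((i : ℕ) + 1) = -(-1) ^ (i : ℕ) := by rw [pow_succ]; ring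
    have hw : ∀ x, wVec n ⬝ᵥ (burauGL (-1 : ℤˣ) i).1.mulVec x = wVec n ⬝ᵥ x := by
      intro x
      rw [key, dotProduct_add, dotProduct_smul, dotProduct_add]
      simp [wVec, strand, strandSucc, h]
    ext b
    have hb := hw (Pi.single b 1)
    rw [Matrix.dotProduct_mulVec] at hb
    simpa using hb

/-- The integral Burau representation as a homomorphism `B_n → Γ_{n-1}`. -/
def burauToGam (n : ℕ) : BraidGroup n →* Gam n :=
  (BraidGroup.integralBurau n).codRestrict (Gam n) (by
    intro b
    have h : (Gam n).comap (BraidGroup.integralBurau n) = ⊤ := by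
      rw [eq_top_iff, ← PresentedGroup.closure_range_of, Subgroup.closure_le]
      rintro _ ⟨i, rfl⟩
      change BraidGroup.integralBurau n (BraidGroup.σ i) ∈ Gam n
      rw [BraidGroup.integralBurau, BraidGroup.burau, BraidGroup.lift_σ]
      exact burauGL_mem_Gam i
    have hb : b ∈ (Gam n).comap (BraidGroup.integralBurau n) := h ▸ Subgroup.mem_top b
    exact hb)

/-! Since `braidCongruence n ℓ` is the preimage of the kernel of reduction modulo `ℓ`, its image is
`burauRange n ⊓ (reduceMod n ℓ).ker`. The heart of the matter is that the Burau image contains all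
of `GamLevel n 2` (`GamLevel_two_le_burauRange`). This settles even `ℓ`. For `n = 2, 3` every
element of `Gam n` reduces modulo 2 to a permutation matrix, hence agrees modulo 2 with some braid.

For odd `ℓ`, the representation modulo 2 is the permutation representation, and `σ i ^ ℓ` lies in
`braidCongruence n ℓ` and still induces a transposition. So `braidCongruence n ℓ` surjects onto the
symmetric group. A matrix congruent to 1 modulo 2 and modulo `ℓ` is so modulo `2 * ℓ`, so the
representation descends to the injection `ι`.

For level two, each `σ i` acts as the transvection along `e_i + e_{i+1}`. Let `congStab n m` be the
part of level two that fixes `e_j` for `j ≥ m`; induction on `m` puts it into the image. The step is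
an orbit statement: some `g` in the image and in `congStab n (m + 1)` agrees with a given `A` on
`e_m`, so that `g⁻¹ * A` lies in `congStab n m`. If `m + 1` is even (`exists_mulVec_basisVec_eq`),
the full twist, a squared transvection along `headVec n (m + 1)`, supplies the moves. If `m + 1` is
odd (`exists_mulVec_headVec_eq`), the lattice `pairSpan n (m + 1)` is symplectic, and a Euclidean
descent brings a vector of the orbit to a standard position. -/

namespace IntegralBurau

open scoped Matrix
open BraidGroup

variable {n : ℕ}

/-! ### Coordinates, alternating sums and pairings with special vectors. -/

/-- The `i`-th coordinate of `x`, zero outside the range. -/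
def coord (x : Fin n → ℤ) (i : ℕ) : ℤ := if h : i < n then x ⟨i, h⟩ else 0

theorem coord_val (x : Fin n → ℤ) (i : Fin n) : coord x i = x i := by simp [coord]

theorem coord_of_lt (x : Fin n → ℤ) {i : ℕ} (h : i < n) : coord x i = x ⟨i, h⟩ := by
  simp [coord, h]

theorem coord_of_le (x : Fin n → ℤ) {i : ℕ} (h : n ≤ i) : coord x i = 0 := by
  simp [coord, h.not_gt]

theorem coord_ext {x y : Fin n → ℤ} (h : ∀ i < n, coord x i = coord y i) : x = y := by
  ext i
  rw [← coord_val x, ← coord_val y, h i i.2]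

@[simp] theorem coord_add (x y : Fin n → ℤ) (i : ℕ) : coord (x + y) i = coord x i + coord y i := by
  unfold coord; split_ifs <;> simp

@[simp] theorem coord_sub (x y : Fin n → ℤ) (i : ℕ) : coord (x - y) i = coord x i - coord y i := by
  unfold coord; split_ifs <;> simp

@[simp] theorem coord_neg (x : Fin n → ℤ) (i : ℕ) : coord (-x) i = -coord x i := by
  unfold coord; split_ifs <;> simp

@[simp] theorem coord_zero (i : ℕ) : coord (0 : Fin n → ℤ) i = 0 := by
  unfold coord; split_ifs <;> simp

@[simp] theorem coord_smul (k : ℤ) (x : Fin n → ℤ) (i : ℕ) : coord (k • x) i = k * coord x i := by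
  unfold coord; split_ifs <;> simp

theorem coord_ofFn (f : ℕ → ℤ) {i : ℕ} (h : i < n) : coord (fun j : Fin n => f j) i = f i := by
  simp [coord, h]

/-- The alternating sum of the first `k` coordinates. -/
def altSum (k : ℕ) (x : Fin n → ℤ) : ℤ := ∑ i ∈ Finset.range k, (-1) ^ i * coord x i

theorem altSum_succ (k : ℕ) (x : Fin n → ℤ) :
    altSum (k + 1) x = altSum k x + (-1) ^ k * coord x k := Finset.sum_range_succ _ _

@[simp] theorem altSum_zero (x : Fin n → ℤ) : altSum 0 x = 0 := rfl

@[simp] theorem altSum_add (k : ℕ) (x y : Fin n → ℤ) :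
    altSum k (x + y) = altSum k x + altSum k y := by
  simp [altSum, mul_add, Finset.sum_add_distrib]

@[simp] theorem altSum_sub (k : ℕ) (x y : Fin n → ℤ) :
    altSum k (x - y) = altSum k x - altSum k y := by
  simp [altSum, mul_sub, Finset.sum_sub_distrib]

@[simp] theorem altSum_neg (k : ℕ) (x : Fin n → ℤ) : altSum k (-x) = -altSum k x := by
  simp [altSum]

@[simp] theorem altSum_smul (k : ℕ) (a : ℤ) (x : Fin n → ℤ) :
    altSum k (a • x) = a * altSum k x := by
  simp only [altSum, coord_smul, Finset.mul_sum]
  exact Finset.sum_congr rfl fun i _ => by ring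

theorem wVec_dotProduct (x : Fin n → ℤ) : wVec n ⬝ᵥ x = altSum n x := by
  simp only [dotProduct, wVec, altSum, Finset.sum_range, coord_val]

theorem altSum_eq_of_coord_eq_zero {k m : ℕ} (h : k ≤ m) {x : Fin n → ℤ}
    (hx : ∀ j, k ≤ j → coord x j = 0) : altSum m x = altSum k x := by
  induction m, h using Nat.le_induction with
  | base => rfl
  | succ m hm ih => rw [altSum_succ, ih, hx m hm, mul_zero, add_zero]

/-- The vector `e_i + e_{i+1}`. -/
def pairVec (n i : ℕ) : Fin n → ℤ := fun j => if (j : ℕ) = i ∨ (j : ℕ) = i + 1 then 1 else 0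

/-- The sum of the first `m` basis vectors. -/
def headVec (n m : ℕ) : Fin n → ℤ := fun j => if (j : ℕ) < m then 1 else 0

/-- The basis vector `e_i`. -/
def basisVec (n i : ℕ) : Fin n → ℤ := fun j => if (j : ℕ) = i then 1 else 0

theorem coord_pairVec {i j : ℕ} (h : j < n) :
    coord (pairVec n i) j = if j = i ∨ j = i + 1 then 1 else 0 :=
  coord_ofFn (fun j => if j = i ∨ j = i + 1 then 1 else 0) h

theorem coord_headVec {m j : ℕ} (h : j < n) : coord (headVec n m) j = if j < m then 1 else 0 :=
  coord_ofFn (fun j => if j < m then 1 else 0) h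

theorem coord_basisVec {i j : ℕ} (h : j < n) : coord (basisVec n i) j = if j = i then 1 else 0 :=
  coord_ofFn (fun j => if j = i then 1 else 0) h

theorem headVec_self : headVec n n = vVec n := by
  funext j; simp [headVec, vVec]

theorem headVec_succ (m : ℕ) : headVec n (m + 1) = headVec n m + basisVec n m := by
  funext j
  simp only [headVec, basisVec, Pi.add_apply]
  grind

theorem headVec_add_two (m : ℕ) : headVec n (m + 2) = headVec n m + pairVec n m := by
  funext j
  simp only [headVec, pairVec, Pi.add_apply]
  grind

theorem pairVec_eq (i : ℕ) : pairVec n i = basisVec n i + basisVec n (i + 1) := by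
  funext j
  simp only [pairVec, basisVec, Pi.add_apply]
  grind

@[simp] theorem altForm_add_left' (u v w : Fin n → ℤ) :
    altForm (u + v) w = altForm u w + altForm v w := altForm_add_left u v w

@[simp] theorem altForm_add_right' (u v w : Fin n → ℤ) :
    altForm u (v + w) = altForm u v + altForm u w := altForm_add_right u v w

@[simp] theorem altForm_smul_left' (c : ℤ) (u v : Fin n → ℤ) :
    altForm (c • u) v = c * altForm u v := altForm_smul_left c u v

@[simp] theorem altForm_smul_right' (c : ℤ) (u v : Fin n → ℤ) :
    altForm u (c • v) = c * altForm u v := altForm_smul_right c u v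

@[simp] theorem altForm_neg_left (u v : Fin n → ℤ) : altForm (-u) v = -altForm u v := by
  rw [← neg_one_smul ℤ u, altForm_smul_left]; ring

@[simp] theorem altForm_neg_right (u v : Fin n → ℤ) : altForm u (-v) = -altForm u v := by
  rw [← neg_one_smul ℤ v, altForm_smul_right]; ring

@[simp] theorem altForm_sub_left (u v w : Fin n → ℤ) :
    altForm (u - v) w = altForm u w - altForm v w := by
  rw [sub_eq_add_neg, altForm_add_left, altForm_neg_left]; ring

@[simp] theorem altForm_sub_right (u v w : Fin n → ℤ) :
    altForm u (v - w) = altForm u v - altForm u w := by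
  rw [sub_eq_add_neg, altForm_add_right, altForm_neg_right]; ring

@[simp] theorem altForm_zero_left (u : Fin n → ℤ) : altForm 0 u = 0 := by simp [altForm]

@[simp] theorem altForm_zero_right (u : Fin n → ℤ) : altForm u 0 = 0 := by simp [altForm]

@[simp] theorem altForm_self (u : Fin n → ℤ) : altForm u u = 0 := by
  have := altForm_swap u u
  omega

theorem altForm_pairVec {i : ℕ} (h : i + 1 < n) (x : Fin n → ℤ) :
    altForm x (pairVec n i) = coord x i - coord x (i + 1) := by
  have key := altForm_strand (⟨i, by omega⟩ : Fin (n - 1)) x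
  have h1 : (Pi.single (strand (⟨i, by omega⟩ : Fin (n - 1))) 1 +
      Pi.single (strandSucc (⟨i, by omega⟩ : Fin (n - 1))) 1 : Fin n → ℤ) = pairVec n i := by
    funext j
    simp only [pairVec, Pi.add_apply, Pi.single_apply, strand, strandSucc, Fin.ext_iff]
    grind
  rw [h1] at key
  rw [key, coord_of_lt x (by omega : i < n), coord_of_lt x h]
  rfl

/-- For even `m` the head vector is a sum of disjoint consecutive pairs, and each pair contributes a
difference of neighbouring coordinates. -/
theorem altForm_headVec {m : ℕ} (hm : Even m) (h : m ≤ n) (x : Fin n → ℤ) :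
    altForm x (headVec n m) = altSum m x := by
  obtain ⟨k, rfl⟩ := hm
  induction k with
  | zero =>
    have : headVec n (0 + 0) = 0 := by funext j; simp [headVec]
    rw [this]; simp
  | succ k ih =>
    rw [show k + 1 + (k + 1) = k + k + 1 + 1 by ring, headVec_add_two, altForm_add_right,
      ih (by omega), altForm_pairVec (by omega), altSum_succ, altSum_succ, pow_succ,
      Even.neg_one_pow ⟨k, rfl⟩]
    ring

theorem altForm_basisVec_last (hn : 0 < n) (x : Fin n → ℤ) :
    altForm x (basisVec n (n - 1)) = coord x (n - 1) - (-1) ^ (n - 1) * altSum n x := by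
  obtain ⟨k, rfl⟩ : ∃ k, n = k + 1 := ⟨n - 1, by omega⟩
  have h1 : basisVec (k + 1) (k + 1 - 1) = Pi.single (Fin.last k) 1 := by
    funext j
    simp only [basisVec, Pi.single_apply, Fin.ext_iff, Fin.val_last, Nat.add_sub_cancel]
  rw [h1, altForm, Matrix.mulVec_single_one, dotProduct, Fin.sum_univ_castSucc, altSum,
    Finset.sum_range_succ, Finset.sum_range, Nat.add_sub_cancel]
  have h2 : ((-1 : ℤ) ^ k) * (-1) ^ k = 1 := by rw [← pow_add]; exact Even.neg_one_pow ⟨k, rfl⟩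
  have h3 : ∀ i : Fin k, x i.castSucc * (altMatrix (k + 1)).col (Fin.last k) i.castSucc =
      -(-1) ^ k * ((-1) ^ (i : ℕ) * coord x i) := by
    intro i
    have : coord x i = x i.castSucc := coord_val x i.castSucc
    simp only [this, Matrix.col_apply, altMatrix, Matrix.of_apply, Fin.castSucc_lt_last, if_true,
      Fin.val_castSucc, Fin.val_last, pow_succ, pow_add]
    ring
  rw [Finset.sum_congr rfl fun i _ => h3 i, ← Finset.mul_sum]
  simp only [Matrix.col_apply, altMatrix, Matrix.of_apply, lt_irrefl, if_false, if_true, mul_zero]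
  linear_combination coord x k * h2

/-! ### Transvections and congruences. -/

theorem GL_ext {A B : GL (Fin n) ℤ} (h : ∀ x, A.1 *ᵥ x = B.1 *ᵥ x) : A = B :=
  Units.ext (Matrix.mulVec_injective (funext h))

@[simp] theorem GL_mul_mulVec (A B : GL (Fin n) ℤ) (x : Fin n → ℤ) :
    (A * B).1 *ᵥ x = A.1 *ᵥ (B.1 *ᵥ x) := by
  rw [Units.val_mul, Matrix.mulVec_mulVec]

@[simp] theorem GL_one_mulVec (x : Fin n → ℤ) : (1 : GL (Fin n) ℤ).1 *ᵥ x = x := by simp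

@[simp] theorem GL_inv_mulVec_mulVec (A : GL (Fin n) ℤ) (x : Fin n → ℤ) :
    (A⁻¹).1 *ᵥ (A.1 *ᵥ x) = x := by
  rw [← GL_mul_mulVec, inv_mul_cancel, GL_one_mulVec]

@[simp] theorem GL_mulVec_inv_mulVec (A : GL (Fin n) ℤ) (x : Fin n → ℤ) :
    A.1 *ᵥ ((A⁻¹).1 *ᵥ x) = x := by
  rw [← GL_mul_mulVec, mul_inv_cancel, GL_one_mulVec]

theorem transvection_aux (k : ℤ) (c x : Fin n → ℤ) :
    (1 + k • Matrix.vecMulVec c (altMatrix n *ᵥ c)) *ᵥ x = x + (k * altForm x c) • c := by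
  rw [Matrix.add_mulVec, Matrix.one_mulVec, Matrix.smul_mulVec, Matrix.vecMulVec_mulVec,
    op_smul_eq_smul, smul_smul, altForm, dotProduct_comm]

/-- The power `x ↦ x + k ⟨x, c⟩ c` of the transvection along `c`. -/
def transv (k : ℤ) (c : Fin n → ℤ) : GL (Fin n) ℤ where
  val := 1 + k • Matrix.vecMulVec c (altMatrix n *ᵥ c)
  inv := 1 + (-k) • Matrix.vecMulVec c (altMatrix n *ᵥ c)
  val_inv := by
    apply Matrix.mulVec_injective
    funext x
    rw [← Matrix.mulVec_mulVec, transvection_aux, transvection_aux]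
    simp only [altForm_add_left, altForm_smul_left, altForm_self, Matrix.one_mulVec]
    module
  inv_val := by
    apply Matrix.mulVec_injective
    funext x
    rw [← Matrix.mulVec_mulVec, transvection_aux, transvection_aux]
    simp only [altForm_add_left, altForm_smul_left, altForm_self, Matrix.one_mulVec]
    module

@[simp] theorem transv_mulVec (k : ℤ) (c x : Fin n → ℤ) :
    (transv k c).1 *ᵥ x = x + (k * altForm x c) • c := transvection_aux k c x

theorem transv_mul (k l : ℤ) (c : Fin n → ℤ) :
    transv k c * transv l c = transv (k + l) c := by
  refine GL_ext fun x => ?_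
  simp only [GL_mul_mulVec, transv_mulVec, altForm_add_left, altForm_smul_left, altForm_self]
  module

theorem transv_zero (c : Fin n → ℤ) : transv 0 c = 1 := GL_ext fun x => by simp

theorem transv_inv (k : ℤ) (c : Fin n → ℤ) : (transv k c)⁻¹ = transv (-k) c := by
  rw [inv_eq_iff_mul_eq_one, transv_mul, add_neg_cancel, transv_zero]

theorem transv_zpow (k j : ℤ) (c : Fin n → ℤ) : transv k c ^ j = transv (k * j) c := by
  induction j with
  | zero => simp [transv_zero]
  | succ j ih => rw [zpow_add_one, ih, transv_mul, mul_add, mul_one]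
  | pred j ih => rw [zpow_sub_one, ih, transv_inv, transv_mul]; congr 1; ring

theorem transv_mul_mem {H : Subgroup (GL (Fin n) ℤ)} {k : ℤ} {c : Fin n → ℤ}
    (h : transv k c ∈ H) (j : ℤ) : transv (k * j) c ∈ H := transv_zpow k j c ▸ H.zpow_mem h j

/-- Invariance of the form is all that matters here. Conjugation by braids thus carries known
transvections in the image to new ones. -/
theorem transv_conj {g : GL (Fin n) ℤ} (hg : g ∈ Gam n) (k : ℤ) (c : Fin n → ℤ) :
    g * transv k c * g⁻¹ = transv k (g.1 *ᵥ c) := by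
  refine GL_ext fun x => ?_
  have h := hg.1 ((g⁻¹).1 *ᵥ x) c
  rw [GL_mulVec_inv_mulVec] at h
  simp only [GL_mul_mulVec, transv_mulVec, Matrix.mulVec_add, Matrix.mulVec_smul,
    GL_mulVec_inv_mulVec, h]

/-- Congruence modulo `ℓ` in terms of the action on vectors. -/
theorem mem_ker_reduceMod {ℓ : ℕ} {A : GL (Fin n) ℤ} :
    A ∈ (reduceMod n ℓ).ker ↔ ∀ x, ∃ y, A.1 *ᵥ x = x + (ℓ : ℤ) • y := by
  have h1 : A ∈ (reduceMod n ℓ).ker ↔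
      ∀ i j, (ℓ : ℤ) ∣ A.1 i j - (1 : Matrix (Fin n) (Fin n) ℤ) i j := by
    rw [MonoidHom.mem_ker, Units.ext_iff, ← Matrix.ext_iff]
    refine forall_congr' fun i => forall_congr' fun j => ?_
    rw [← ZMod.intCast_zmod_eq_zero_iff_dvd, Int.cast_sub, sub_eq_zero]
    simp [reduceMod, Matrix.one_apply]
  rw [h1]
  constructor
  · intro h x
    choose B hB using h
    refine ⟨Matrix.of B *ᵥ x, ?_⟩
    have : A.1 = 1 + (ℓ : ℤ) • Matrix.of B := by
      ext i j
      simp only [Matrix.add_apply, Matrix.smul_apply, Matrix.of_apply, smul_eq_mul, ← hB]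
      ring
    rw [this, Matrix.add_mulVec, Matrix.one_mulVec, Matrix.smul_mulVec]
  · intro h i j
    obtain ⟨y, hy⟩ := h (Pi.single j 1)
    refine ⟨y i, ?_⟩
    have := congrFun hy i
    simp only [Matrix.mulVec_single_one, Matrix.col_apply, Pi.add_apply, Pi.smul_apply,
      smul_eq_mul] at this
    rw [this, Matrix.one_apply, Pi.single_apply]
    ring

theorem Gam.altForm_mulVec {A : GL (Fin n) ℤ} (hA : A ∈ Gam n) (x y : Fin n → ℤ) :
    altForm (A.1 *ᵥ x) (A.1 *ᵥ y) = altForm x y := hA.1 x y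

theorem Gam.altSum_mulVec {A : GL (Fin n) ℤ} (hA : A ∈ Gam n) (x : Fin n → ℤ) :
    altSum n (A.1 *ᵥ x) = altSum n x := by
  rw [← wVec_dotProduct, ← wVec_dotProduct, Matrix.dotProduct_mulVec, hA.2.2]

theorem transv_mem_Gam {c : Fin n → ℤ} (hv : altForm (vVec n) c = 0) (hw : altSum n c = 0)
    (k : ℤ) : transv k c ∈ Gam n := by
  refine ⟨fun x y => ?_, ?_, ?_⟩
  · simp only [transv_mulVec, altForm_add_left, altForm_add_right, altForm_smul_left,
      altForm_smul_right, altForm_self]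
    rw [altForm_swap c y]
    ring
  · rw [transv_mulVec, hv]
    simp
  · ext b
    have h := transv_mulVec k c (Pi.single b 1)
    apply_fun (wVec n ⬝ᵥ ·) at h
    rw [dotProduct_add, dotProduct_smul, wVec_dotProduct c, hw, Matrix.dotProduct_mulVec] at h
    simpa using h

/-! ### The Burau image, the lattices `pairSpan` and the stabilizers `congStab`. -/

/-- The image of the integral Burau representation. -/
def burauRange (n : ℕ) : Subgroup (GL (Fin n) ℤ) := (integralBurau n).range

theorem burauRange_le_Gam : burauRange n ≤ Gam n := by
  rintro _ ⟨b, rfl⟩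
  exact (burauToGam n b).2

theorem integralBurau_σ {i : ℕ} (h : i + 1 < n) :
    integralBurau n (σ ⟨i, by omega⟩) = transv 1 (pairVec n i) := by
  rw [integralBurau, burau, lift_σ]
  refine GL_ext fun x => coord_ext fun j hj => ?_
  rw [transv_mulVec, coord_add, coord_smul, altForm_pairVec h, coord_pairVec hj,
    coord_of_lt _ hj, coord_of_lt x hj, coord_of_lt x h, coord_of_lt x (by omega : i < n)]
  simp only [burauGL, burauMatrix_mulVec, strand, strandSucc, Fin.ext_iff, Units.val_neg,
    Units.val_one]
  grind

theorem transv_pairVec_mem {i : ℕ} (h : i + 1 < n) (k : ℤ) :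
    transv k (pairVec n i) ∈ burauRange n := by
  have := transv_mul_mem (H := burauRange n) ⟨_, integralBurau_σ h⟩ k
  rwa [one_mul] at this

/-- The lattice of the vectors in the first `m` coordinates that are orthogonal to `wVec n`. -/
def pairSpan (n m : ℕ) : AddSubgroup (Fin n → ℤ) :=
  AddSubgroup.closure {c | ∃ i, i + 1 < m ∧ c = pairVec n i}

theorem pairVec_mem_pairSpan {i m : ℕ} (h : i + 1 < m) : pairVec n i ∈ pairSpan n m :=
  AddSubgroup.subset_closure ⟨i, h, rfl⟩

theorem pairSpan_mono {k m : ℕ} (h : k ≤ m) : pairSpan n k ≤ pairSpan n m :=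
  AddSubgroup.closure_mono fun _ ⟨i, hi, hc⟩ => ⟨i, by omega, hc⟩

theorem altSum_pairVec {i m : ℕ} (hm : m ≤ n) (h : i + 1 < m) :
    altSum m (pairVec n i) = 0 := by
  rw [altSum_eq_of_coord_eq_zero (k := i + 2) (by omega), altSum_succ, altSum_succ, altSum,
    Finset.sum_eq_zero]
  · rw [coord_pairVec (by omega), coord_pairVec (by omega), pow_succ]
    simp
  · intro j hj
    rw [Finset.mem_range] at hj
    rw [coord_pairVec (by omega), if_neg (by omega), mul_zero]
  · intro j hj
    rcases lt_or_ge j n with h' | h'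
    · rw [coord_pairVec h', if_neg (by omega)]
    · exact coord_of_le _ h'

theorem coord_eq_zero_of_mem_pairSpan {m j : ℕ} (hj : m ≤ j) {x : Fin n → ℤ}
    (hx : x ∈ pairSpan n m) : coord x j = 0 := by
  rcases lt_or_ge j n with h' | h'
  · induction hx using AddSubgroup.closure_induction with
    | mem x hx =>
      obtain ⟨i, hi, rfl⟩ := hx
      rw [coord_pairVec h', if_neg (by omega)]
    | zero => simp
    | add x y _ _ hx hy => simp [hx, hy]
    | neg x _ hx => simp [hx]
  · exact coord_of_le _ h'

theorem altSum_eq_zero_of_mem_pairSpan {m : ℕ} (hm : m ≤ n) {x : Fin n → ℤ}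
    (hx : x ∈ pairSpan n m) : altSum m x = 0 := by
  induction hx using AddSubgroup.closure_induction with
  | mem x hx =>
    obtain ⟨i, hi, rfl⟩ := hx
    exact altSum_pairVec hm hi
  | zero => simpa using altSum_smul m 0 (0 : Fin n → ℤ)
  | add x y _ _ hx hy => simp [hx, hy]
  | neg x _ hx => simp [hx]

/-- Subtracting a multiple of the last pair clears the last coordinate and keeps the alternating
sum; a single remaining coordinate is then zero. -/
theorem mem_pairSpan {m : ℕ} (hm : m ≤ n) {x : Fin n → ℤ} (h : ∀ j, m ≤ j → coord x j = 0)
    (hs : altSum m x = 0) : x ∈ pairSpan n m := by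
  induction m generalizing x with
  | zero =>
    have : x = 0 := coord_ext fun i _ => by rw [h i (by omega), coord_zero]
    rw [this]
    exact zero_mem _
  | succ m ih =>
    rcases Nat.eq_zero_or_pos m with rfl | hm0
    · have : x = 0 := coord_ext fun i _ => by
        rw [coord_zero]
        rcases Nat.eq_zero_or_pos i with rfl | hi
        · simpa [altSum_succ] using hs
        · exact h i hi
      rw [this]
      exact zero_mem _
    · obtain ⟨i, rfl⟩ : ∃ i, m = i + 1 := ⟨m - 1, by omega⟩
      have key : x - coord x (i + 1) • pairVec n i ∈ pairSpan n (i + 1) := by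
        have hc : ∀ j, i + 1 ≤ j → coord (x - coord x (i + 1) • pairVec n i) j = 0 := by
          intro j hj
          rcases lt_or_ge j n with h' | h'
          · rw [coord_sub, coord_smul, coord_pairVec h']
            rcases eq_or_ne j (i + 1) with rfl | hne
            · simp
            · rw [h j (by omega), if_neg (by omega)]
              simp
          · exact coord_of_le _ h'
        refine ih (by omega) hc ?_
        rw [← altSum_eq_of_coord_eq_zero (m := i + 1 + 1) (by omega) hc, altSum_sub, altSum_smul,
          hs, altSum_pairVec hm (by omega)]
        simp
      have := add_mem (pairSpan_mono (by omega : i + 1 ≤ i + 1 + 1) key)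
        ((pairSpan n (i + 1 + 1)).zsmul_mem (pairVec_mem_pairSpan (n := n) (i := i) (by omega))
          (coord x (i + 1)))
      simpa using this

/-- The elements of `Γ_{n-1}[2]` that fix all basis vectors from `e_m` on. -/
def congStab (n m : ℕ) : Subgroup (GL (Fin n) ℤ) where
  carrier := {A | A ∈ GamLevel n 2 ∧ ∀ j, m ≤ j → A.1 *ᵥ basisVec n j = basisVec n j}
  one_mem' := ⟨one_mem _, by simp⟩
  mul_mem' := by
    rintro A B ⟨hA, hA'⟩ ⟨hB, hB'⟩
    exact ⟨mul_mem hA hB, fun j hj => by rw [GL_mul_mulVec, hB' j hj, hA' j hj]⟩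
  inv_mem' := by
    rintro A ⟨hA, hA'⟩
    refine ⟨inv_mem hA, fun j hj => ?_⟩
    conv_lhs => rw [← hA' j hj, GL_inv_mulVec_mulVec]

theorem congStab_le_Gam {m : ℕ} : congStab n m ≤ Gam n := fun _ h => h.1.1

/-- Out of range `basisVec n j` is zero, so the stabilizer condition is vacuous. -/
theorem congStab_self : congStab n n = GamLevel n 2 := by
  refine le_antisymm (fun _ h => h.1) fun A h => ⟨h, fun j hj => ?_⟩
  have : basisVec n j = 0 := by
    funext i
    simp only [basisVec, Pi.zero_apply]
    rw [if_neg (by omega)]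
  rw [this, Matrix.mulVec_zero]

theorem exists_mulVec_eq_add_two_smul {m : ℕ} {A : GL (Fin n) ℤ} (hA : A ∈ congStab n m)
    (x : Fin n → ℤ) : ∃ y, A.1 *ᵥ x = x + (2 : ℤ) • y :=
  mem_ker_reduceMod.1 hA.1.2 x

/-- By duality: `A` preserves pairings with the vectors it fixes. Pairing with the last basis
vector, together with the invariant alternating sum, recovers the last coordinate; pairing with
`pairVec n j` then passes from `j + 1` down to `j`. -/
theorem coord_mulVec_of_mem_congStab {m : ℕ} {A : GL (Fin n) ℤ} (hA : A ∈ congStab n m)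
    (x : Fin n → ℤ) {j : ℕ} (hj : m ≤ j) : coord (A.1 *ᵥ x) j = coord x j := by
  have hG := congStab_le_Gam hA
  rcases lt_or_ge j n with h' | h'
  · obtain ⟨d, hd⟩ : ∃ d, n = j + d + 1 := ⟨n - j - 1, by omega⟩
    induction d generalizing j with
    | zero =>
      have h1 := Gam.altForm_mulVec hG x (basisVec n (n - 1))
      rw [hA.2 (n - 1) (by omega), altForm_basisVec_last (by omega),
        altForm_basisVec_last (by omega), Gam.altSum_mulVec hG] at h1
      obtain rfl : j = n - 1 := by omega
      linarith
    | succ d ih =>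
      have h1 := Gam.altForm_mulVec hG x (pairVec n j)
      have h2 : A.1 *ᵥ pairVec n j = pairVec n j := by
        rw [pairVec_eq, Matrix.mulVec_add, hA.2 j hj, hA.2 (j + 1) (by omega)]
      rw [h2, altForm_pairVec (by omega), altForm_pairVec (by omega),
        ih (j := j + 1) (by omega) (by omega) (by omega)] at h1
      linarith
  · rw [coord_of_le _ h', coord_of_le _ h']

/-- The head vector is `vVec n` minus basis vectors that `A` fixes. -/
theorem mulVec_headVec_of_mem_congStab {m : ℕ} (hm : m ≤ n) {A : GL (Fin n) ℤ}
    (hA : A ∈ congStab n m) : A.1 *ᵥ headVec n m = headVec n m := by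
  have key : ∀ k, m ≤ k → k ≤ n → A.1 *ᵥ headVec n k = headVec n k := by
    intro k hk hkn
    induction hkn using Nat.decreasingInduction with
    | self => rw [headVec_self]; exact (congStab_le_Gam hA).2.1
    | of_succ k _ ih =>
      have := ih (by omega)
      rw [headVec_succ, Matrix.mulVec_add, hA.2 k hk] at this
      exact add_right_cancel this
  exact key m le_rfl hm

theorem altForm_eq_zero_of_mem_pairSpan {m : ℕ} (hm : m ≤ n) {y c : Fin n → ℤ}
    (hy : ∀ i, i + 1 < m → coord y i = coord y (i + 1)) (hc : c ∈ pairSpan n m) :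
    altForm y c = 0 := by
  induction hc using AddSubgroup.closure_induction with
  | mem x hx =>
    obtain ⟨i, hi, rfl⟩ := hx
    rw [altForm_pairVec (by omega), hy i hi, sub_self]
  | zero => simp
  | add x y _ _ hx hy => simp [hx, hy]
  | neg x _ hx => simp [hx]

theorem transv_mem_Gam_of_mem_pairSpan {m : ℕ} (hm : m ≤ n) {c : Fin n → ℤ}
    (hc : c ∈ pairSpan n m) (k : ℤ) : transv k c ∈ Gam n := by
  have hc' := pairSpan_mono hm hc
  refine transv_mem_Gam ?_ (altSum_eq_zero_of_mem_pairSpan le_rfl hc') k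
  refine altForm_eq_zero_of_mem_pairSpan le_rfl (fun i hi => ?_) hc'
  rw [← headVec_self, coord_headVec (by omega), coord_headVec (by omega), if_pos hi,
    if_pos (by omega)]

theorem transv_two_mem_congStab {m : ℕ} (hm : m ≤ n) {c : Fin n → ℤ}
    (hc : c ∈ pairSpan n m) : transv 2 c ∈ congStab n m := by
  refine ⟨⟨transv_mem_Gam_of_mem_pairSpan hm hc 2, ?_⟩, fun j hj => ?_⟩
  · exact mem_ker_reduceMod.2 fun x => ⟨altForm x c • c, by rw [transv_mulVec, smul_smul]; rfl⟩
  · rw [transv_mulVec, altForm_eq_zero_of_mem_pairSpan hm _ hc]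
    · simp
    · intro i hi
      rw [coord_basisVec (by omega), coord_basisVec (by omega), if_neg (by omega),
        if_neg (by omega)]

/-! ### Products of the generators -/

/-- The product `σ_{k-1} ⋯ σ_0` in the Burau representation. -/
def coxeter (n : ℕ) : ℕ → GL (Fin n) ℤ
  | 0 => 1
  | k + 1 => transv 1 (pairVec n k) * coxeter n k

theorem coxeter_mem {k : ℕ} (hk : k < n) : coxeter n k ∈ burauRange n := by
  induction k with
  | zero => exact one_mem _
  | succ k ih => exact mul_mem (transv_pairVec_mem hk 1) (ih (by omega))

theorem coord_coxeter {k : ℕ} (hk : k < n) (x : Fin n → ℤ) {i : ℕ} (hi : i < n) :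
    coord ((coxeter n k).1 *ᵥ x) i =
      if i < k then 2 * coord x 0 - coord x (i + 1) else if i = k then coord x 0
      else coord x i := by
  induction k generalizing i with
  | zero =>
    rw [coxeter, GL_one_mulVec]
    grind
  | succ k ih =>
    rw [coxeter, GL_mul_mulVec, transv_mulVec, coord_add, coord_smul, altForm_pairVec hk,
      ih (by omega) hi, ih (by omega) (by omega), ih (by omega) hk, coord_pairVec hi]
    grind

/-- With indices modulo `k + 1` the case `i = k` is not special, as `2 x_0 - x_0 = x_0`. So each
application shifts cyclically, changes the sign and adds twice the leading coordinate. -/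
theorem coord_coxeter_pow {k : ℕ} (hk : k < n) (x : Fin n → ℤ) (j : ℕ) {i : ℕ} (hi : i ≤ k) :
    coord ((coxeter n k ^ j).1 *ᵥ x) i =
      (-1) ^ j * coord x ((i + j) % (k + 1)) +
        2 * ∑ l ∈ Finset.range j, (-1) ^ l * coord x (l % (k + 1)) := by
  induction j generalizing i with
  | zero =>
    rw [pow_zero, GL_one_mulVec, add_zero, Nat.mod_eq_of_lt (by omega)]
    simp
  | succ j ih =>
    have h : coord ((coxeter n k).1 *ᵥ ((coxeter n k ^ j).1 *ᵥ x)) i =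
        2 * coord ((coxeter n k ^ j).1 *ᵥ x) 0 -
          coord ((coxeter n k ^ j).1 *ᵥ x) ((i + 1) % (k + 1)) := by
      rw [coord_coxeter hk _ (by omega)]
      rcases hi.lt_or_eq with h | rfl
      · rw [if_pos h, Nat.mod_eq_of_lt (by omega)]
      · rw [if_neg (lt_irrefl _), if_pos rfl, Nat.mod_self]
        ring
    rw [pow_succ', GL_mul_mulVec, h, ih (by omega),
      ih (Nat.le_of_lt_succ (Nat.mod_lt _ (by omega))), Finset.sum_range_succ, zero_add,
      Nat.mod_add_mod, show i + 1 + j = i + (j + 1) by ring, pow_succ]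
    ring

/-- This power is the full twist: the cyclic shift closes up after `k + 1` steps, and every
coordinate has entered the accumulated sum once. -/
theorem coxeter_pow_mulVec {k : ℕ} (hk : k < n) (x : Fin n → ℤ) {i : ℕ} (hi : i < n) :
    coord ((coxeter n k ^ (k + 1)).1 *ᵥ x) i =
      if i ≤ k then (-1) ^ (k + 1) * coord x i + 2 * altSum (k + 1) x else coord x i := by
  split_ifs with h
  · rw [coord_coxeter_pow hk x _ h, Nat.add_mod_right, Nat.mod_eq_of_lt (by omega), altSum]
    congr 2
    refine Finset.sum_congr rfl fun l hl => ?_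
    rw [Nat.mod_eq_of_lt (Finset.mem_range.1 hl)]
  · generalize k + 1 = j
    induction j with
    | zero => simp
    | succ j ih =>
      rw [pow_succ', GL_mul_mulVec, coord_coxeter hk _ hi, if_neg (by omega), if_neg (by omega), ih]

theorem transv_two_headVec_mem {m : ℕ} (hm : Even m) (h : m ≤ n) :
    transv 2 (headVec n m) ∈ burauRange n := by
  rcases m with _ | k
  · have : headVec n 0 = 0 := by funext j; simp [headVec]
    rw [this, show transv 2 (0 : Fin n → ℤ) = 1 from GL_ext fun x => by simp]
    exact one_mem _
  · have : transv 2 (headVec n (k + 1)) = coxeter n k ^ (k + 1) := by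
      refine GL_ext fun x => coord_ext fun i hi => ?_
      rw [coxeter_pow_mulVec (by omega) x hi, transv_mulVec, coord_add, coord_smul,
        altForm_headVec hm h, coord_headVec hi, hm.neg_one_pow]
      grind
    rw [this]
    exact pow_mem (coxeter_mem (by omega)) _

/-- The hyperelliptic involution of the first `m` strands, for odd `m`. -/
theorem exists_neg_mem {m : ℕ} (hm : Odd m) (h : m ≤ n) :
    ∃ g ∈ burauRange n ⊓ congStab n m, ∀ x ∈ pairSpan n m, g.1 *ᵥ x = -x := by
  obtain ⟨k, rfl⟩ : ∃ k, m = k + 1 := ⟨m - 1, by have := hm.pos; omega⟩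
  have hG : coxeter n k ^ (k + 1) ∈ burauRange n := pow_mem (coxeter_mem (by omega)) _
  refine ⟨coxeter n k ^ (k + 1), ⟨hG, ⟨burauRange_le_Gam hG, ?_⟩, fun j hj => ?_⟩, fun x hx => ?_⟩
  · refine mem_ker_reduceMod.2 fun x => ?_
    -- For odd `k + 1` the new coordinate is `-x_i + 2 S = x_i + 2 (S - x_i)`, with `S` the
    -- alternating sum.
    refine ⟨fun i => if (i : ℕ) ≤ k then altSum (k + 1) x - coord x i else 0, ?_⟩
    refine coord_ext fun i hi => ?_
    rw [coxeter_pow_mulVec (by omega) x hi, coord_add, coord_smul,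
      coord_ofFn (fun i => if i ≤ k then altSum (k + 1) x - coord x i else 0) hi,
      hm.neg_one_pow]
    push_cast
    grind
  · refine coord_ext fun i hi => ?_
    have h0 : altSum (k + 1) (basisVec n j) = 0 := by
      refine Finset.sum_eq_zero fun l hl => ?_
      rw [Finset.mem_range] at hl
      rw [coord_basisVec (by omega), if_neg (by omega), mul_zero]
    rw [coxeter_pow_mulVec (by omega) _ hi, h0, coord_basisVec hi]
    split_ifs <;> omega
  · refine coord_ext fun i hi => ?_
    rw [coxeter_pow_mulVec (by omega) _ hi, altSum_eq_zero_of_mem_pairSpan h hx, hm.neg_one_pow,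
      coord_neg]
    split_ifs with h'
    · ring
    · rw [coord_eq_zero_of_mem_pairSpan (by omega) hx, neg_zero]

theorem transv_pairVec_of_disjoint {i j : ℕ} (hi : i + 1 < n)
    (h : i + 1 < j ∨ j + 1 < i) (k : ℤ) :
    (transv k (pairVec n i)).1 *ᵥ pairVec n j = pairVec n j := by
  rw [transv_mulVec, altForm_pairVec hi, coord_pairVec (by omega), coord_pairVec hi,
    if_neg (by omega), if_neg (by omega)]
  simp

/-- Used with `transv_conj` to slide a pair by one strand. -/
theorem transv_mul_transv_pairVec {i : ℕ} (h : i + 2 < n) :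
    (transv 1 (pairVec n i) * transv 1 (pairVec n (i + 1))).1 *ᵥ pairVec n i =
      pairVec n (i + 1) := by
  have h1 : altForm (pairVec n i) (pairVec n (i + 1)) = 1 := by
    rw [altForm_pairVec (by omega), coord_pairVec (by omega), coord_pairVec (by omega),
      if_pos (by omega), if_neg (by omega), sub_zero]
  have h2 := altForm_swap (pairVec n (i + 1)) (pairVec n i)
  rw [GL_mul_mulVec, transv_mulVec, transv_mulVec, altForm_add_left, altForm_smul_left, h2, h1,
    altForm_self]
  module

/-! ### Orbits under squared transvections. -/

/-- If `⟨b, c⟩ = 0` and `H` contains the squared transvections along `b`, `c`, `b + c`, then it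
contains the map `x ↦ x + 2 ⟨x, b⟩ c + 2 ⟨x, c⟩ b`. -/
theorem exists_cross_of_add {H : Subgroup (GL (Fin n) ℤ)} {b c : Fin n → ℤ}
    (hbc : altForm b c = 0) (hb : transv 2 b ∈ H) (hc : transv 2 c ∈ H)
    (h : transv 2 (b + c) ∈ H) :
    ∃ E ∈ H, ∀ x, E.1 *ᵥ x = x + (2 * altForm x b) • c + (2 * altForm x c) • b := by
  have hcb : altForm c b = 0 := by rw [altForm_swap, hbc, neg_zero]
  refine ⟨transv 2 (b + c) * (transv 2 b)⁻¹ * (transv 2 c)⁻¹,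
    mul_mem (mul_mem h (inv_mem hb)) (inv_mem hc), fun x => ?_⟩
  simp only [transv_inv, GL_mul_mulVec, transv_mulVec, altForm_add_left, altForm_smul_left,
    altForm_add_right, altForm_self, hbc, hcb]
  module

/-- The variant for a head vector `b` and a pair `c`, where the difference is the accessible
combination. -/
theorem exists_cross_of_sub {H : Subgroup (GL (Fin n) ℤ)} {b c : Fin n → ℤ}
    (hbc : altForm b c = 0) (hb : transv 2 b ∈ H) (hc : transv 2 c ∈ H)
    (h : transv 2 (b - c) ∈ H) :
    ∃ E ∈ H, ∀ x, E.1 *ᵥ x = x + (2 * altForm x b) • c + (2 * altForm x c) • b := by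
  have hcb : altForm c b = 0 := by rw [altForm_swap, hbc, neg_zero]
  refine ⟨(transv 2 (b - c))⁻¹ * transv 2 b * transv 2 c,
    mul_mem (mul_mem (inv_mem h) hb) hc, fun x => ?_⟩
  simp only [transv_inv, GL_mul_mulVec, transv_mulVec, altForm_add_left, altForm_smul_left,
    altForm_sub_right, altForm_self, hbc, hcb]
  module

/-- All displacements `y` stay orthogonal to `b`, so `a + 2y` keeps pairing to the unit `ε` with
`b`. Hence transvections along `b` adjust the `b`-component freely, and the cross maps add `±c` up
to such a component. -/
theorem exists_mulVec_eq_of_mem_closure {H : Subgroup (GL (Fin n) ℤ)} {a b : Fin n → ℤ}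
    {C : Set (Fin n → ℤ)} {ε : ℤ} (hε : ε * ε = 1) (hab : altForm a b = ε)
    (hb : transv 2 b ∈ H) (hC : ∀ c ∈ C, altForm b c = 0)
    (hE : ∀ c ∈ C, ∃ E ∈ H, ∀ x,
      E.1 *ᵥ x = x + (2 * altForm x b) • c + (2 * altForm x c) • b)
    {y : Fin n → ℤ} (hy : y ∈ AddSubgroup.closure (insert b C)) :
    ∃ g ∈ H, g.1 *ᵥ a = a + (2 : ℤ) • y := by
  let P : (Fin n → ℤ) → Prop := fun y => ∃ g ∈ H, g.1 *ᵥ a = a + (2 : ℤ) • y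
  have hPb : ∀ (k : ℤ) (y : Fin n → ℤ), altForm y b = 0 → P y → P (y + k • b) := by
    rintro k y hyb ⟨g, hg, hga⟩
    refine ⟨transv (2 * (ε * k)) b * g, mul_mem (transv_mul_mem hb _) hg, ?_⟩
    rw [GL_mul_mulVec, hga, transv_mulVec, altForm_add_left, altForm_smul_left, hyb, hab,
      show 2 * (ε * k) * (ε + 2 * 0) = 2 * (ε * ε) * k by ring, hε]
    module
  have hPc : ∀ c ∈ C, ∀ y, altForm y b = 0 → (P y → P (y + c)) ∧ (P y → P (y - c)) := by
    intro c hc y hyb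
    have hcb : altForm c b = 0 := by rw [altForm_swap, hC c hc, neg_zero]
    obtain ⟨E, hEH, hE⟩ := hE c hc
    have hE' : ∀ x, (E⁻¹).1 *ᵥ x = x - (2 * altForm x b) • c - (2 * altForm x c) • b := by
      intro x
      rw [← GL_inv_mulVec_mulVec E (x - (2 * altForm x b) • c - (2 * altForm x c) • b), hE]
      congr 1
      simp only [altForm_sub_left, altForm_smul_left, altForm_self, hcb, hC c hc]
      module
    have key : ∀ s : ℤ, s = 1 ∨ s = -1 → P y → P (y + (s * ε) • c) := by
      rintro s hs ⟨g, hg, hga⟩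
      -- `E` or its inverse adds the desired multiple of `c`, with a multiple of `b` that `hPb`
      -- removes afterwards.
      have h1 : P (y + (s * ε) • c + (s * altForm (a + (2 : ℤ) • y) c) • b) := by
        rcases hs with rfl | rfl
        · refine ⟨E * g, mul_mem hEH hg, ?_⟩
          rw [GL_mul_mulVec, hga, hE]
          simp only [altForm_add_left, altForm_smul_left, hyb, hab]
          module
        · refine ⟨E⁻¹ * g, mul_mem (inv_mem hEH) hg, ?_⟩
          rw [GL_mul_mulVec, hga, hE']
          simp only [altForm_add_left, altForm_smul_left, hyb, hab]
          module
      have h2 := hPb (-(s * altForm (a + (2 : ℤ) • y) c)) _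
        (by simp only [altForm_add_left, altForm_smul_left, altForm_self, hyb, hcb]; ring) h1
      rwa [neg_smul, add_neg_cancel_right] at h2
    have hε' : ε = 1 ∨ ε = -1 := by
      rcases Int.mul_eq_one_iff_eq_one_or_neg_one.1 hε with h | h
      exacts [Or.inl h.1, Or.inr h.1]
    have k1 := key 1 (Or.inl rfl)
    have k2 := key (-1) (Or.inr rfl)
    rcases hε' with rfl | rfl
    · exact ⟨by simpa using k1, by simpa [sub_eq_add_neg] using k2⟩
    · exact ⟨by simpa using k2, by simpa [sub_eq_add_neg] using k1⟩
  -- An equivalence for all `z` orthogonal to `b` composes under sums and inverts under negation, as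
  -- closure induction needs.
  have main : altForm y b = 0 ∧ ∀ z, altForm z b = 0 → (P z ↔ P (z + y)) := by
    induction hy using AddSubgroup.closure_induction with
    | mem c hc =>
      rcases hc with rfl | hc
      · refine ⟨altForm_self _, fun z hz => ⟨fun h => by simpa using hPb 1 z hz h, fun h => ?_⟩⟩
        simpa using hPb (-1) (z + c) (by simp [hz]) h
      · have hcb : altForm c b = 0 := by rw [altForm_swap, hC c hc, neg_zero]
        refine ⟨hcb, fun z hz => ⟨(hPc c hc z hz).1, fun h => ?_⟩⟩
        simpa using (hPc c hc (z + c) (by simp [hz, hcb])).2 h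
    | zero => simp
    | add x y _ _ hx hy =>
      refine ⟨by simp [hx.1, hy.1], fun z hz => ?_⟩
      rw [hx.2 z hz, hy.2 (z + x) (by simp [hz, hx.1]), add_assoc]
    | neg x _ hx =>
      refine ⟨by simp [hx.1], fun z hz => ?_⟩
      rw [hx.2 (z + -x) (by simp [hz, hx.1]), neg_add_cancel_right]
  have h0 : P 0 := ⟨1, one_mem _, by simp⟩
  have := (main.2 0 (by simp)).1 h0
  rwa [zero_add] at this

/-- Removing the last pair leaves a shorter head vector of even length. Braids of the first `m`
strands fix `headVec n m` and slide the removed pair to any position. -/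
theorem transv_headVec_sub_pairVec_mem {m i : ℕ} (hm : Even m) (h : m ≤ n) (hi : i + 1 < m) :
    transv 2 (headVec n m - pairVec n i) ∈ burauRange n := by
  obtain ⟨k, rfl⟩ : ∃ k, m = k + 2 := ⟨m - 2, by omega⟩
  have hik : i ≤ k := by omega
  induction hik using Nat.decreasingInduction with
  | self =>
    rw [headVec_add_two, add_sub_cancel_right]
    exact transv_two_headVec_mem (by simpa [Nat.even_add] using hm) (by omega)
  | of_succ i hik ih =>
    have ih := ih (by omega)
    set g := transv 1 (pairVec n i) * transv 1 (pairVec n (i + 1)) with hg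
    have hgG : g ∈ burauRange n :=
      mul_mem (transv_pairVec_mem (by omega) 1) (transv_pairVec_mem (by omega) 1)
    have hv : ∀ j, j + 1 < k + 2 → (transv 1 (pairVec n j)).1 *ᵥ headVec n (k + 2) =
        headVec n (k + 2) := by
      intro j hj
      rw [transv_mulVec, altForm_pairVec (by omega), coord_headVec (by omega),
        coord_headVec (by omega), if_pos (by omega), if_pos (by omega)]
      simp
    have h1 : g.1 *ᵥ (headVec n (k + 2) - pairVec n i) =
        headVec n (k + 2) - pairVec n (i + 1) := by
      rw [Matrix.mulVec_sub, hg, transv_mul_transv_pairVec (by omega), GL_mul_mulVec,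
        hv (i + 1) (by omega), hv i (by omega)]
    rw [← h1, ← transv_conj (burauRange_le_Gam hgG)] at ih
    have := mul_mem (mul_mem (inv_mem hgG) ih) hgG
    simpa [mul_assoc] using this

theorem transv_two_pairVec_mem {i m : ℕ} (hm : m ≤ n) (h : i + 1 < m) :
    transv 2 (pairVec n i) ∈ burauRange n ⊓ congStab n m :=
  ⟨transv_pairVec_mem (by omega) 2, transv_two_mem_congStab hm (pairVec_mem_pairSpan h)⟩

theorem headVec_mem_pairSpan {m : ℕ} (hm : Even m) (h : m ≤ n) : headVec n m ∈ pairSpan n m := by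
  refine mem_pairSpan h (fun j hj => ?_) ?_
  · rcases lt_or_ge j n with h' | h'
    · rw [coord_headVec h', if_neg (by omega)]
    · exact coord_of_le _ h'
  · rw [← altForm_headVec hm h, altForm_self]

/-- For an even number `m + 1` of strands, the Burau image is transitive on the
`congStab n (m + 1)`-orbit of `e_m`. -/
theorem exists_mulVec_basisVec_eq {m : ℕ} (hm : Even (m + 1)) (h : m + 1 ≤ n)
    {A : GL (Fin n) ℤ} (hA : A ∈ congStab n (m + 1)) :
    ∃ g ∈ burauRange n ⊓ congStab n (m + 1), g.1 *ᵥ basisVec n m = A.1 *ᵥ basisVec n m := by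
  obtain ⟨y, hy⟩ := exists_mulVec_eq_add_two_smul hA (basisVec n m)
  rw [hy]
  -- `A` preserves the outer coordinates and the alternating sum, so both vanish on `2y`, hence on
  -- `y`.
  have hyW : y ∈ pairSpan n (m + 1) := by
    have h0 : ∀ j, m + 1 ≤ j → coord y j = 0 := by
      intro j hj
      have := coord_mulVec_of_mem_congStab hA (basisVec n m) hj
      rw [hy, coord_add, coord_smul] at this
      omega
    refine mem_pairSpan h h0 ?_
    have := Gam.altSum_mulVec (congStab_le_Gam hA) (basisVec n m)
    rw [hy, altSum_add, altSum_smul] at this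
    rw [← altSum_eq_of_coord_eq_zero h h0]
    omega
  have hb : transv 2 (headVec n (m + 1)) ∈ burauRange n ⊓ congStab n (m + 1) :=
    ⟨transv_two_headVec_mem hm h, transv_two_mem_congStab h (headVec_mem_pairSpan hm h)⟩
  have hC : ∀ c ∈ {c | ∃ i, i + 1 < m + 1 ∧ c = pairVec n i},
      altForm (headVec n (m + 1)) c = 0 := by
    rintro _ ⟨i, hi, rfl⟩
    rw [altForm_pairVec (by omega), coord_headVec (by omega), coord_headVec (by omega),
      if_pos (by omega), if_pos (by omega), sub_self]
  refine exists_mulVec_eq_of_mem_closure (ε := -1) (by norm_num) ?_ hb hC ?_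
    (AddSubgroup.closure_mono (Set.subset_insert _ _) hyW)
  · rw [altForm_headVec hm h, altSum_succ, coord_basisVec (by omega), if_pos rfl, altSum,
      Finset.sum_eq_zero]
    · rw [zero_add, mul_one]
      exact Odd.neg_one_pow (by simpa [Nat.even_add_one] using hm)
    · intro i hi
      rw [Finset.mem_range] at hi
      rw [coord_basisVec (by omega), if_neg (by omega), mul_zero]
  · rintro _ ⟨i, hi, rfl⟩
    refine exists_cross_of_sub (hC _ ⟨i, hi, rfl⟩) hb (transv_two_pairVec_mem h hi)
      ⟨transv_headVec_sub_pairVec_mem hm h hi, transv_two_mem_congStab h ?_⟩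
    exact sub_mem (headVec_mem_pairSpan hm h) (pairVec_mem_pairSpan hi)

/-! ### Euclidean descent for an odd number of strands. -/

/-- The balanced remainder `r` of `β` modulo `2α` is even and nonzero, so `0 < |r| < |α|` by parity.
Adding `2r` or `-2r`, whichever has the sign opposite to `α`, shrinks `|α|`. -/
theorem exists_natAbs_add_lt {α β : ℤ} (hα : Odd α) (hβ : Even β) (h : ¬ α ∣ β) :
    ∃ k l : ℤ, (α + 2 * l * (β - 2 * k * α)).natAbs < α.natAbs := by
  obtain ⟨u, rfl⟩ := hα
  obtain ⟨v, rfl⟩ := hβ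
  have hpos : 0 < 2 * (2 * u + 1).natAbs := by omega
  obtain ⟨k, hk⟩ : ∃ k : ℤ, Int.bmod (v + v) (2 * (2 * u + 1).natAbs) =
      v + v - 2 * k * (2 * u + 1) := by
    obtain ⟨k, hk⟩ := Int.dvd_self_sub_bmod (x := v + v) (m := 2 * (2 * u + 1).natAbs)
    rcases Int.natAbs_eq (2 * u + 1) with h2 | h2
    · refine ⟨k, ?_⟩
      rw [Nat.cast_mul, ← h2] at hk
      push_cast at hk
      linarith
    · refine ⟨-k, ?_⟩
      have h3 : ((2 * u + 1).natAbs : ℤ) = -(2 * u + 1) := by omega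
      rw [Nat.cast_mul, h3] at hk
      push_cast at hk
      linarith
  have hlo := Int.le_bmod (x := v + v) hpos
  have hhi := Int.bmod_lt (x := v + v) hpos
  rw [hk] at hlo hhi
  have h0 : v + v - 2 * k * (2 * u + 1) ≠ 0 := fun h0 => h ⟨2 * k, by linarith⟩
  have hw : v + v - 2 * k * (2 * u + 1) = 2 * (v - k * (2 * u + 1)) := by ring
  refine ⟨k, ?_⟩
  rw [hw] at hlo hhi h0 ⊢
  generalize v - k * (2 * u + 1) = w at *
  by_cases hs : 0 < u * 2 + 1 ↔ 0 < w
  · exact ⟨-1, by omega⟩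
  · exact ⟨1, by omega⟩

/-- For `i + 1 < k` the inductive hypothesis covers the pairs `i` and `k`, and a braid disjoint from
pair `i` slides `k` to `k + 1`. For `i + 1 = k` this braid would move pair `i`, so pair `k - 2` is
slid to `k - 1` instead. -/
theorem transv_two_pairVec_add_pairVec_mem {k i : ℕ} (hk : Even k) (h : k + 3 ≤ n)
    (IH : congStab n (k + 2) ≤ burauRange n) (hi : i < k) :
    transv 2 (pairVec n i + pairVec n (k + 1)) ∈ burauRange n := by
  have step : ∀ i, i + 1 < k → transv 2 (pairVec n i + pairVec n (k + 1)) ∈ burauRange n := by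
    intro i hi
    have h1 : transv 2 (pairVec n i + pairVec n k) ∈ burauRange n :=
      IH (transv_two_mem_congStab (by omega)
        (add_mem (pairVec_mem_pairSpan (by omega)) (pairVec_mem_pairSpan (by omega))))
    have hg : transv 1 (pairVec n k) * transv 1 (pairVec n (k + 1)) ∈ burauRange n :=
      mul_mem (transv_pairVec_mem (by omega) 1) (transv_pairVec_mem (by omega) 1)
    have h2 := transv_conj (burauRange_le_Gam hg) 2 (pairVec n i + pairVec n k)
    rw [Matrix.mulVec_add, transv_mul_transv_pairVec (by omega), GL_mul_mulVec,
      transv_pairVec_of_disjoint (by omega) (by omega),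
      transv_pairVec_of_disjoint (by omega) (by omega)] at h2
    rw [← h2]
    exact mul_mem (mul_mem hg h1) (inv_mem hg)
  rcases Nat.lt_or_ge (i + 1) k with hik | hik
  · exact step i hik
  · obtain ⟨j, rfl⟩ : ∃ j, k = j + 2 := ⟨k - 2, by have := hk.two_dvd; omega⟩
    obtain rfl : i = j + 1 := by omega
    have hg : transv 1 (pairVec n j) * transv 1 (pairVec n (j + 1)) ∈ burauRange n :=
      mul_mem (transv_pairVec_mem (by omega) 1) (transv_pairVec_mem (by omega) 1)
    have h2 := transv_conj (burauRange_le_Gam hg) 2 (pairVec n j + pairVec n (j + 2 + 1))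
    rw [Matrix.mulVec_add, transv_mul_transv_pairVec (by omega), GL_mul_mulVec,
      transv_pairVec_of_disjoint (by omega) (by omega),
      transv_pairVec_of_disjoint (by omega) (by omega)] at h2
    rw [← h2]
    exact mul_mem (mul_mem hg (step j (by omega))) (inv_mem hg)

theorem mulVec_mem_pairSpan {m : ℕ} (hm : m ≤ n) {A : GL (Fin n) ℤ} (hA : A ∈ congStab n m)
    {x : Fin n → ℤ} (hx : x ∈ pairSpan n m) : A.1 *ᵥ x ∈ pairSpan n m := by
  have h0 : ∀ j, m ≤ j → coord (A.1 *ᵥ x) j = 0 := fun j hj => by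
    rw [coord_mulVec_of_mem_congStab hA x hj, coord_eq_zero_of_mem_pairSpan hj hx]
  refine mem_pairSpan hm h0 ?_
  rw [← altSum_eq_of_coord_eq_zero hm h0, Gam.altSum_mulVec (congStab_le_Gam hA)]
  exact altSum_eq_zero_of_mem_pairSpan le_rfl (pairSpan_mono hm hx)

theorem dvd_altSum_sub_ite {k : ℕ} {α r : ℤ} {x : Fin n → ℤ} (h : ∀ i < k, α ∣ coord x i - r) :
    α ∣ altSum k x - if Even k then 0 else r := by
  induction k with
  | zero => simp
  | succ k ih =>
    have h1 := ih fun i hi => h i (by omega)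
    have h2 := h k (by omega)
    rw [altSum_succ]
    rcases Nat.even_or_odd k with hk | hk
    · rw [if_pos hk] at h1
      rw [if_neg (by simpa [Nat.even_add_one] using hk), hk.neg_one_pow]
      rw [show altSum k x + 1 * coord x k - r = altSum k x - 0 + (coord x k - r) by ring]
      exact dvd_add h1 h2
    · rw [if_neg (by simpa using hk)] at h1
      rw [if_pos (by simpa [Nat.even_add_one] using hk), hk.neg_one_pow]
      rw [show altSum k x + -1 * coord x k - 0 = altSum k x - r - (coord x k - r) by ring]
      exact dvd_sub h1 h2

/-- An integer dividing the pairings of `x` with a generating set of the symplectic lattice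
`pairSpan n (k + 3)` divides `x`. -/
theorem dvd_coord_of_dvd_altForm {k : ℕ} (hk : Even k) (h : k + 3 ≤ n) {α : ℤ}
    {x : Fin n → ℤ} (hx : x ∈ pairSpan n (k + 3))
    (hC : ∀ i < k, α ∣ altForm x (pairVec n i)) (hb : α ∣ altForm x (pairVec n (k + 1)))
    (ha : α ∣ altForm x (headVec n (k + 2))) (i : ℕ) : α ∣ coord x i := by
  have hS := altSum_eq_zero_of_mem_pairSpan h hx
  rw [altForm_headVec (by simpa [Nat.even_add] using hk) (by omega)] at ha
  rw [altForm_pairVec (by omega)] at hb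
  rw [altSum_succ, Even.neg_one_pow (by simpa [Nat.even_add] using hk)] at hS
  have h2 : α ∣ coord x (k + 2) := by
    have : coord x (k + 2) = -altSum (k + 2) x := by linarith
    rw [this]
    exact ha.neg_right
  have h1 : α ∣ coord x (k + 1) := by
    have := dvd_add hb h2
    rwa [sub_add_cancel] at this
  have hr : ∀ i ≤ k, α ∣ coord x i - coord x k := by
    intro i hi
    induction hi using Nat.decreasingInduction with
    | self => simp
    | of_succ i hi ih =>
      have h3 := hC i hi
      rw [altForm_pairVec (by omega)] at h3
      have := dvd_add h3 ih
      rwa [sub_add_sub_cancel] at this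
  -- The first `k + 1` coordinates are congruent modulo `α`. Their number is odd, so their
  -- alternating sum is the common residue.
  have h0 : α ∣ coord x k := by
    have h3 := dvd_altSum_sub_ite (k := k + 1) fun i hi => hr i (by omega)
    rw [if_neg (by simpa [Nat.even_add_one] using hk)] at h3
    rw [altSum_succ] at ha
    have h4 : α ∣ altSum (k + 1) x := (dvd_add_left (h1.mul_left _)).1 ha
    have := dvd_sub h4 h3
    rwa [sub_sub_cancel] at this
  rcases Nat.lt_or_ge k i with hi | hi
  · rcases Nat.lt_or_ge i (k + 3) with hi' | hi'
    · obtain rfl | rfl : i = k + 1 ∨ i = k + 2 := by omega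
      exacts [h1, h2]
    · rw [coord_eq_zero_of_mem_pairSpan hi' hx]
      exact dvd_zero α
  · have := dvd_add (hr i hi) h0
    rwa [sub_add_cancel] at this

/-- For an odd number `k + 3` of strands, the Burau image is transitive on the
`congStab n (k + 3)`-orbit of `headVec n (k + 2)`. -/
theorem exists_mulVec_headVec_eq {k : ℕ} (hk : Even k) (h : k + 3 ≤ n)
    (IH : congStab n (k + 2) ≤ burauRange n) {A : GL (Fin n) ℤ} (hA : A ∈ congStab n (k + 3)) :
    ∃ g ∈ burauRange n ⊓ congStab n (k + 3),
      g.1 *ᵥ headVec n (k + 2) = A.1 *ᵥ headVec n (k + 2) := by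
  set H := burauRange n ⊓ congStab n (k + 3) with hH
  set a := headVec n (k + 2) with ha
  set b := pairVec n (k + 1) with hb
  have hk2 : Even (k + 2) := by simpa [Nat.even_add] using hk
  have haW : a ∈ pairSpan n (k + 3) :=
    pairSpan_mono (by omega) (headVec_mem_pairSpan hk2 (by omega))
  have hab : altForm a b = 1 := by
    rw [altForm_pairVec (by omega), coord_headVec (by omega), coord_headVec (by omega),
      if_pos (by omega), if_neg (by omega), sub_zero]
  have hba : altForm b a = -1 := by rw [altForm_swap, hab]
  have haH : transv 2 a ∈ H :=
    ⟨transv_two_headVec_mem hk2 (by omega), transv_two_mem_congStab h haW⟩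
  have hbH : transv 2 b ∈ H := transv_two_pairVec_mem h (by omega)
  have hbc : ∀ i < k, altForm b (pairVec n i) = 0 := by
    intro i hi
    rw [altForm_pairVec (by omega), coord_pairVec (by omega), coord_pairVec (by omega),
      if_neg (by omega), if_neg (by omega), sub_zero]
  have hac : ∀ i < k, altForm a (pairVec n i) = 0 := by
    intro i hi
    rw [altForm_pairVec (by omega), coord_headVec (by omega), coord_headVec (by omega),
      if_pos (by omega), if_pos (by omega), sub_self]
  have hE : ∀ i < k, ∃ E ∈ H, ∀ x, E.1 *ᵥ x =
      x + (2 * altForm x b) • pairVec n i + (2 * altForm x (pairVec n i)) • b := by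
    intro i hi
    refine exists_cross_of_add (hbc i hi) hbH (transv_two_pairVec_mem h (by omega)) ⟨?_, ?_⟩
    · rw [add_comm]
      exact transv_two_pairVec_add_pairVec_mem hk h IH hi
    · exact transv_two_mem_congStab h
        (add_mem (pairVec_mem_pairSpan (by omega)) (pairVec_mem_pairSpan (by omega)))
  have hHstab : H ≤ congStab n (k + 3) := inf_le_right
  -- vectors in the orbit of `a` that pair to one with `b`
  have hone : ∀ B ∈ congStab n (k + 3), altForm (B.1 *ᵥ a) b = 1 →
      ∃ g ∈ H, g.1 *ᵥ a = B.1 *ᵥ a := by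
    intro B hB h1
    have hW := mulVec_mem_pairSpan h hB haW
    obtain ⟨y, hy⟩ := exists_mulVec_eq_add_two_smul hB a
    rw [hy] at h1 hW ⊢
    have hyW : y ∈ pairSpan n (k + 3) := by
      have hc : ∀ j, k + 3 ≤ j → coord y j = 0 := by
        intro j hj
        have := coord_eq_zero_of_mem_pairSpan hj hW
        rw [coord_add, coord_smul, coord_eq_zero_of_mem_pairSpan hj haW] at this
        omega
      refine mem_pairSpan h hc ?_
      have := altSum_eq_zero_of_mem_pairSpan h hW
      rw [altSum_add, altSum_smul, altSum_eq_zero_of_mem_pairSpan h haW] at this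
      omega
    have hyb : altForm y b = 0 := by
      rw [altForm_add_left, altForm_smul_left, hab] at h1
      omega
    rw [altForm_pairVec (by omega)] at hyb
    -- Orthogonality to `b` makes the coordinates `k + 1` and `k + 2` of `y` equal, so one multiple
    -- of `b` clears both. The rest is spanned by pairs orthogonal to `b`.
    have hz : y - coord y (k + 1) • b ∈ pairSpan n (k + 1) := by
      have hc : ∀ j, k + 1 ≤ j → coord (y - coord y (k + 1) • b) j = 0 := by
        intro j hj
        rcases lt_or_ge j n with h' | h'
        · rw [coord_sub, coord_smul, coord_pairVec h']
          rcases Nat.lt_or_ge j (k + 3) with h3 | h3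
          · obtain rfl | rfl : j = k + 1 ∨ j = k + 2 := by omega
            · simp
            · rw [if_pos (by omega)]
              linarith
          · rw [coord_eq_zero_of_mem_pairSpan h3 hyW, if_neg (by omega)]
            simp
        · exact coord_of_le _ h'
      refine mem_pairSpan (by omega) hc ?_
      rw [← altSum_eq_of_coord_eq_zero (m := k + 3) (by omega) hc, altSum_sub, altSum_smul,
        altSum_pairVec h (by omega), altSum_eq_zero_of_mem_pairSpan h hyW]
      simp
    refine exists_mulVec_eq_of_mem_closure (C := {c | ∃ i, i + 1 < k + 1 ∧ c = pairVec n i})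
      (ε := 1) (by norm_num) hab hbH ?_ ?_ ?_
    · rintro _ ⟨i, hi, rfl⟩
      exact hbc i (by omega)
    · rintro _ ⟨i, hi, rfl⟩
      exact hE i (by omega)
    · have h1 := AddSubgroup.closure_mono (Set.subset_insert b _) hz
      have h2 := AddSubgroup.zsmul_mem _ (AddSubgroup.subset_closure
        (Set.mem_insert b {c | ∃ i, i + 1 < k + 1 ∧ c = pairVec n i})) (coord y (k + 1))
      have := add_mem h1 h2
      rwa [sub_add_cancel] at this
  -- a vector of the orbit with minimal pairing with `b`
  let f : GL (Fin n) ℤ → ℕ := fun g => (altForm (g.1 *ᵥ (A.1 *ᵥ a)) b).natAbs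
  obtain ⟨h₀, h₀H, hmin⟩ : ∃ g ∈ H, ∀ g' ∈ H, f g ≤ f g' := by
    refine ⟨Function.argminOn f H ⟨1, one_mem H⟩, Function.argminOn_mem _ _ _, fun g' hg' => ?_⟩
    exact Function.argminOn_le f _ hg'
  set α := altForm (h₀.1 *ᵥ (A.1 *ᵥ a)) b with hα
  have hdvd : ∀ g ∈ H, altForm (g.1 *ᵥ (A.1 *ᵥ a)) b = α →
      α ∣ altForm (g.1 *ᵥ (A.1 *ᵥ a)) a := by
    intro g hg hgα
    by_contra hnd
    obtain ⟨y, hy⟩ := exists_mulVec_eq_add_two_smul (mul_mem (hHstab hg) hA) a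
    rw [GL_mul_mulVec] at hy
    set q := g.1 *ᵥ (A.1 *ᵥ a) with hq
    have hodd : Odd α := by
      rw [← hgα, hy, altForm_add_left, altForm_smul_left, hab]
      exact ⟨altForm y b, by ring⟩
    have heven : Even (altForm q a) := by
      rw [hy, altForm_add_left, altForm_smul_left, altForm_self]
      exact ⟨altForm y a, by ring⟩
    -- Powers of the squared transvections along `b` and `a` realise the Euclidean step on the
    -- pairings with `a` and `b`, against minimality.
    obtain ⟨s, t, hst⟩ := exists_natAbs_add_lt hodd heven hnd
    refine absurd (hmin (transv (2 * t) a * transv (2 * s) b * g)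
      (mul_mem (mul_mem (transv_mul_mem haH t) (transv_mul_mem hbH s)) hg)) (not_le.2 ?_)
    have : altForm ((transv (2 * t) a * transv (2 * s) b * g).1 *ᵥ (A.1 *ᵥ a)) b =
        α + 2 * t * (altForm q a - 2 * s * α) := by
      rw [GL_mul_mulVec, GL_mul_mulVec, ← hq]
      simp only [transv_mulVec, altForm_add_left, altForm_smul_left, altForm_self, hab, hba, hgα]
      ring
    change Int.natAbs _ < Int.natAbs _
    rw [this, ← hα]
    exact hst
  set q := h₀.1 *ᵥ (A.1 *ᵥ a) with hq
  have hB : h₀ * A ∈ congStab n (k + 3) := mul_mem (hHstab h₀H) hA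
  have hqB : q = (h₀ * A).1 *ᵥ a := by rw [GL_mul_mulVec]
  have hqW : q ∈ pairSpan n (k + 3) := hqB ▸ mulVec_mem_pairSpan h hB haW
  have hqa : α ∣ altForm q a := hdvd h₀ h₀H rfl
  have hodd : Odd α := by
    obtain ⟨y, hy⟩ := exists_mulVec_eq_add_two_smul hB a
    rw [hα, hqB, hy, altForm_add_left, altForm_smul_left, hab]
    exact ⟨altForm y b, by ring⟩
  have hqc : ∀ i < k, α ∣ altForm q (pairVec n i) := by
    intro i hi
    obtain ⟨E, hEH, hE⟩ := hE i hi
    have hcb : altForm (pairVec n i) b = 0 := by rw [altForm_swap, hbc i hi, neg_zero]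
    have hca : altForm (pairVec n i) a = 0 := by rw [altForm_swap, hac i hi, neg_zero]
    -- The cross map keeps the pairing with `b` and changes the pairing with `a` by `-2 ⟨q, c⟩`, for
    -- `c` the `i`-th pair. So `α` divides `2 ⟨q, c⟩`, and `α` is odd.
    have h1 := hdvd (E * h₀) (mul_mem hEH h₀H) (by
      rw [GL_mul_mulVec, ← hq, hE]
      simp only [altForm_add_left, altForm_smul_left, altForm_self, hcb]
      ring)
    rw [GL_mul_mulVec, ← hq, hE] at h1
    simp only [altForm_add_left, altForm_smul_left, hca, hba, mul_zero, add_zero] at h1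
    have h2 : α ∣ altForm q (pairVec n i) * 2 := by
      rw [mul_neg_one, ← sub_eq_add_neg] at h1
      have := dvd_sub hqa h1
      rwa [sub_sub_cancel, mul_comm] at this
    refine IsCoprime.dvd_of_dvd_mul_right ?_ h2
    obtain ⟨u, hu⟩ := hodd
    exact ⟨1, -u, by rw [hu]; ring⟩
  have hαu : α = 1 ∨ α = -1 := by
    -- If `α` divides `q`, it divides the preimage `a`, which has a coordinate equal to 1.
    have hall := dvd_coord_of_dvd_altForm hk h hqW hqc dvd_rfl hqa
    choose z hz using hall
    have h1 : q = α • fun i : Fin n => z i := by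
      funext i
      rw [← coord_val q, hz]
      rfl
    have h2 : a = α • ((h₀ * A)⁻¹).1 *ᵥ fun i : Fin n => z i := by
      rw [← Matrix.mulVec_smul, ← h1, hqB, GL_inv_mulVec_mulVec]
    have h3 := congrArg (coord · 0) h2
    simp only [coord_smul, ha] at h3
    rw [coord_headVec (by omega), if_pos (by omega)] at h3
    exact Int.isUnit_iff.1 (IsUnit.of_mul_eq_one _ h3.symm)
  rcases hαu with h1 | h1
  · obtain ⟨g, hg, hga⟩ := hone (h₀ * A) hB (by rw [← hqB, ← hα, h1])
    refine ⟨h₀⁻¹ * g, mul_mem (inv_mem h₀H) hg, ?_⟩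
    rw [GL_mul_mulVec, hga, GL_mul_mulVec, GL_inv_mulVec_mulVec]
  · obtain ⟨ι, hι, hιneg⟩ := exists_neg_mem (m := k + 3) (by simpa [parity_simps] using hk) h
    obtain ⟨g, hg, hga⟩ := hone (ι * (h₀ * A)) (mul_mem hι.2 hB) (by
      rw [GL_mul_mulVec, ← hqB, hιneg q hqW, altForm_neg_left, ← hα, h1, neg_neg])
    refine ⟨h₀⁻¹ * (ι⁻¹ * g), mul_mem (inv_mem h₀H) (mul_mem (inv_mem hι) hg), ?_⟩
    simp only [GL_mul_mulVec, hga, GL_inv_mulVec_mulVec]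

/-! ### The level two subgroup lies in the image. -/

/-- The level two subgroups for the first `m` strands lie in the image of the braid group. -/
theorem congStab_le_burauRange {m : ℕ} (hm : m ≤ n) : congStab n m ≤ burauRange n := by
  induction m with
  | zero =>
    intro A hA
    have : A = 1 := GL_ext fun x => coord_ext fun i _ => by
      rw [coord_mulVec_of_mem_congStab hA x (by omega), GL_one_mulVec]
    exact this ▸ one_mem _
  | succ m ih =>
    intro A hA
    have ih := ih (by omega)
    suffices ∃ g ∈ burauRange n ⊓ congStab n (m + 1),
        g.1 *ᵥ basisVec n m = A.1 *ᵥ basisVec n m by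
      obtain ⟨g, hg, hgA⟩ := this
      have h1 : g⁻¹ * A ∈ congStab n m := by
        have h2 := mul_mem ((congStab n (m + 1)).inv_mem hg.2) hA
        refine ⟨h2.1, fun j hj => ?_⟩
        rcases hj.lt_or_eq with h | rfl
        · exact h2.2 j h
        · rw [GL_mul_mulVec, ← hgA, GL_inv_mulVec_mulVec]
      simpa using mul_mem hg.1 (ih h1)
    rcases Nat.even_or_odd m with he | ho
    · rcases m with _ | m
      · refine ⟨1, one_mem _, ?_⟩
        have h1 := mulVec_headVec_of_mem_congStab hm hA
        have h2 : headVec n 0 = 0 := by funext j; simp [headVec]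
        rw [headVec_succ, h2, zero_add] at h1
        rw [h1, GL_one_mulVec]
      · obtain ⟨k, rfl⟩ : ∃ k, m = k + 1 :=
          ⟨m - 1, by have := (Nat.even_add_one.1 he); rcases m with _ | m; simp at this; omega⟩
        obtain ⟨g, hg, hgA⟩ :=
          exists_mulVec_headVec_eq (by simpa [Nat.even_add] using he) hm ih hA
        refine ⟨g, hg, ?_⟩
        -- Both `A` and `g` fix the longer head vector, so agreement on the shorter one gives
        -- agreement on the basis vector between them.
        have h1 := mulVec_headVec_of_mem_congStab hm hA
        have h2 := mulVec_headVec_of_mem_congStab hm hg.2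
        rw [headVec_succ, Matrix.mulVec_add] at h1 h2
        rw [hgA] at h2
        exact add_left_cancel (h2.trans h1.symm)
    · exact exists_mulVec_basisVec_eq (by simpa [Nat.even_add_one] using ho) hm hA

theorem GamLevel_two_le_burauRange : GamLevel n 2 ≤ burauRange n :=
  congStab_self (n := n) ▸ congStab_le_burauRange le_rfl

/-! ### Reduction modulo 2 and permutations. -/

/-- The matrices of permutations, as a homomorphism to `GL_n(ℤ/2ℤ)`. -/
def permGL (n : ℕ) : Equiv.Perm (Fin n) →* GL (Fin n) (ZMod 2) :=
  MonoidHom.toHomUnits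
    { toFun := fun π => Matrix.of fun i j => if i = π j then 1 else 0
      map_one' := by
        ext i j
        simp only [Matrix.of_apply, Matrix.one_apply, Equiv.Perm.one_apply]
        rfl
      map_mul' := by
        intro π τ
        ext i j
        simp only [Matrix.of_apply, Matrix.mul_apply, Equiv.Perm.mul_apply, mul_ite, mul_one,
          mul_zero]
        rw [Finset.sum_ite_eq' Finset.univ (τ j) fun k => if i = π k then (1 : ZMod 2) else 0,
          if_pos (Finset.mem_univ _)]
        rfl }

theorem permGL_apply (π : Equiv.Perm (Fin n)) (i j : Fin n) :
    (permGL n π).1 i j = if i = π j then 1 else 0 := rfl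

theorem permGL_injective : Function.Injective (permGL n) := by
  intro π τ h
  ext j
  have h1 := permGL_apply π (π j) j
  rw [h, permGL_apply] at h1
  by_contra hne
  rw [if_neg fun h2 => hne (congrArg Fin.val h2), if_pos rfl] at h1
  exact zero_ne_one h1

/-- Modulo 2 the block `(2, -1; 1, 0)` becomes the matrix of a transposition. -/
theorem reduceMod_two_comp_integralBurau :
    (reduceMod n 2).comp (integralBurau n) = (permGL n).comp (perm n) := by
  refine PresentedGroup.ext fun i => Units.ext ?_
  change (reduceMod n 2 (integralBurau n (σ i))).1 = (permGL n (perm n (σ i))).1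
  ext a b
  rw [permGL_apply, perm, integralBurau, burau, lift_σ, lift_σ]
  have h := strand_ne i
  change ((burauMatrix (-1 : ℤ) i a b : ℤ) : ZMod 2) = _
  have h2 : ((1 - -1 : ℤ) : ZMod 2) = 0 := by decide
  have h3 : ((-1 : ℤ) : ZMod 2) = 1 := by decide
  simp only [burauMatrix, Matrix.of_apply, Equiv.swap_apply_def, apply_ite (Int.cast (R := ZMod 2)),
    h2, h3, Int.cast_one, Int.cast_zero]
  clear h2 h3
  generalize (0 : ZMod 2) = z
  generalize (1 : ZMod 2) = o
  grind

theorem reduceMod_two_integralBurau (b : BraidGroup n) :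
    reduceMod n 2 (integralBurau n b) = permGL n (perm n b) :=
  DFunLike.congr_fun reduceMod_two_comp_integralBurau b

theorem reduceMod_two_integralBurau_eq_iff (b c : BraidGroup n) :
    reduceMod n 2 (integralBurau n b) = reduceMod n 2 (integralBurau n c) ↔
      perm n b = perm n c := by
  rw [reduceMod_two_integralBurau, reduceMod_two_integralBurau, permGL_injective.eq_iff]

theorem subgroup_perm_eq_top (H : Subgroup (Equiv.Perm (Fin n)))
    (h : ∀ i : Fin (n - 1), Equiv.swap (strand i) (strandSucc i) ∈ H) : H = ⊤ := by
  rcases n with _ | n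
  · exact Subsingleton.elim _ _
  · have h1 : Submonoid.closure (Set.range fun i : Fin n => Equiv.swap i.castSucc i.succ) ≤
        H.toSubmonoid := by
      rw [Submonoid.closure_le]
      rintro _ ⟨i, rfl⟩
      exact h i
    rw [Equiv.Perm.mclosure_swap_castSucc_succ] at h1
    exact eq_top_iff.2 fun x _ => h1 (Submonoid.mem_top x)

theorem perm_σ (i : Fin (n - 1)) : perm n (σ i) = Equiv.swap (strand i) (strandSucc i) :=
  lift_σ _ _ _ i

theorem perm_surjective : Function.Surjective (perm n) :=
  MonoidHom.range_eq_top.1 (subgroup_perm_eq_top _ fun i => ⟨σ i, perm_σ i⟩)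

theorem σ_pow_mem_braidCongruence (ℓ : ℕ) (i : Fin (n - 1)) :
    (σ i : BraidGroup n) ^ ℓ ∈ braidCongruence n ℓ := by
  have hi : (i : ℕ) + 1 < n := by omega
  change integralBurau n (σ i ^ ℓ) ∈ (reduceMod n ℓ).ker
  rw [map_pow, integralBurau_σ hi, ← zpow_natCast, transv_zpow, mem_ker_reduceMod]
  exact fun x => ⟨altForm x (pairVec n i) • pairVec n i,
    by rw [transv_mulVec, smul_smul, one_mul]⟩

/-- An odd power of a transposition is the transposition itself. -/
theorem perm_restrict_surjective {ℓ : ℕ} (hℓ : Odd ℓ) :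
    Function.Surjective ((perm n).comp (braidCongruence n ℓ).subtype) := by
  refine MonoidHom.range_eq_top.1 (subgroup_perm_eq_top _ fun i =>
    ⟨⟨_, σ_pow_mem_braidCongruence ℓ i⟩, ?_⟩)
  rw [MonoidHom.comp_apply, Subgroup.subtype_apply, map_pow, perm_σ]
  obtain ⟨k, rfl⟩ := hℓ
  rw [pow_succ, pow_mul, pow_two, Equiv.swap_mul_self, one_pow, one_mul]

theorem map_braidCongruence (ℓ : ℕ) :
    (braidCongruence n ℓ).map (integralBurau n) = burauRange n ⊓ (reduceMod n ℓ).ker := by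
  rw [braidCongruence, ← MonoidHom.comap_ker, Subgroup.map_comap_eq, burauRange]

theorem exists_perm_of_two (M : Fin 2 → Fin 2 → ZMod 2)
    (hr : ∀ i, M i 0 + M i 1 = 1) (hc : ∀ j, M 0 j + M 1 j = 1) :
    ∃ π : Equiv.Perm (Fin 2), ∀ i j, M i j = if i = π j then 1 else 0 := by
  revert M
  decide

theorem exists_perm_of_three (M : Fin 3 → Fin 3 → ZMod 2)
    (hr : ∀ i, M i 0 + M i 1 + M i 2 = 1) (hc : ∀ j, M 0 j + M 1 j + M 2 j = 1)
    (hdet : M 0 0 * M 1 1 * M 2 2 - M 0 0 * M 1 2 * M 2 1 - M 0 1 * M 1 0 * M 2 2 +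
      M 0 1 * M 1 2 * M 2 0 + M 0 2 * M 1 0 * M 2 1 - M 0 2 * M 1 1 * M 2 0 ≠ 0) :
    ∃ π : Equiv.Perm (Fin 3), ∀ i j, M i j = if i = π j then 1 else 0 := by
  revert M
  decide +kernel

/-- Modulo 2, fixing `vVec` and `wVec` says that all row and column sums are 1. In size 2, and in
size 3 with invertibility, only permutation matrices satisfy this. -/
theorem Gam_le_burauRange (hn : n = 2 ∨ n = 3) : Gam n ≤ burauRange n := by
  intro A hA
  have hr : ∀ i, ∑ j, (reduceMod n 2 A).1 i j = 1 := by
    intro i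
    have h := congrFun hA.2.1 i
    simp only [Matrix.mulVec, dotProduct, vVec, mul_one] at h
    have h2 := congrArg (Int.cast (R := ZMod 2)) h
    rw [Int.cast_sum, Int.cast_one] at h2
    exact h2
  have hc : ∀ j, ∑ i, (reduceMod n 2 A).1 i j = 1 := by
    intro j
    have hw : ∀ i : ℕ, (((-1) ^ i : ℤ) : ZMod 2) = 1 := by
      intro i
      rw [Int.cast_pow, show ((-1 : ℤ) : ZMod 2) = 1 by decide, one_pow]
    have h := congrFun hA.2.2 j
    simp only [Matrix.vecMul, dotProduct, wVec] at h
    have h2 := congrArg (Int.cast (R := ZMod 2)) h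
    simp only [Int.cast_sum, Int.cast_mul, hw, one_mul] at h2
    exact h2
  have hπ : ∃ π : Equiv.Perm (Fin n), ∀ i j,
      (reduceMod n 2 A).1 i j = if i = π j then 1 else 0 := by
    rcases hn with rfl | rfl
    · simp only [Fin.sum_univ_two] at hr hc
      exact exists_perm_of_two _ hr hc
    · simp only [Fin.sum_univ_three] at hr hc
      have hdet := ((Matrix.isUnit_iff_isUnit_det _).1 (reduceMod 3 2 A).isUnit).ne_zero
      rw [Matrix.det_fin_three] at hdet
      exact exists_perm_of_three _ hr hc hdet
  obtain ⟨π, hπ⟩ := hπ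
  obtain ⟨b, rfl⟩ := perm_surjective π
  have h1 : reduceMod n 2 A = reduceMod n 2 (integralBurau n b) := by
    rw [reduceMod_two_integralBurau]
    exact Units.ext (Matrix.ext hπ)
  have hb : integralBurau n b ∈ burauRange n := ⟨b, rfl⟩
  have h2 : A * (integralBurau n b)⁻¹ ∈ GamLevel n 2 := by
    refine ⟨mul_mem hA ((Gam n).inv_mem (burauRange_le_Gam hb)), ?_⟩
    exact (MonoidHom.mem_ker).2 (by rw [map_mul, map_inv, h1, mul_inv_cancel])
  simpa using mul_mem (GamLevel_two_le_burauRange h2) hb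

theorem ker_two_inf_ker {ℓ : ℕ} (hℓ : Odd ℓ) {A : GL (Fin n) ℤ} (h2 : A ∈ (reduceMod n 2).ker)
    (h : A ∈ (reduceMod n ℓ).ker) : A ∈ (reduceMod n (2 * ℓ)).ker := by
  rw [mem_ker_reduceMod] at *
  intro x
  obtain ⟨y, hy⟩ := h2 x
  obtain ⟨z, hz⟩ := h x
  obtain ⟨k, rfl⟩ := hℓ
  -- From `2y = (2k + 1) z` follows `z = 2 (y - k z)`.
  refine ⟨y - (k : ℤ) • z, ?_⟩
  have h3 : (2 : ℤ) • y = ((2 * k + 1 : ℕ) : ℤ) • z := add_left_cancel (hy.symm.trans hz)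
  rw [hz]
  push_cast at h3 ⊢
  linear_combination (-(2 * k + 1) : ℤ) • h3

end IntegralBurau

/-! ### The two cases of the theorem. -/

open IntegralBurau in
theorem theoremB (n ℓ : ℕ) :
    ((Even ℓ ∨ n = 2 ∨ n = 3) →
      (braidCongruence n ℓ).map (BraidGroup.integralBurau n) = GamLevel n ℓ) ∧
    (4 ≤ n → Odd ℓ →
      ∃ ι : Equiv.Perm (Fin n) →*
          GamLevel n ℓ ⧸ (GamLevel n (2 * ℓ)).subgroupOf (GamLevel n ℓ),
        Function.Injective ι ∧
        (∀ b : BraidGroup n,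
          GamLevel.toModTwo n ℓ (ι (BraidGroup.perm n b)) = QuotientGroup.mk (burauToGam n b)) ∧
        (braidCongruence n ℓ).map (BraidGroup.integralBurau n) =
          (ι.range.comap (QuotientGroup.mk' ((GamLevel n (2 * ℓ)).subgroupOf (GamLevel n ℓ)))).map
            (GamLevel n ℓ).subtype) := by
  rw [map_braidCongruence]
  refine ⟨fun h => ?_, fun _ hℓ => ?_⟩
  · refine le_antisymm (inf_le_inf_right _ burauRange_le_Gam) fun A hA => ⟨?_, hA.2⟩
    rcases h with h | h
    · exact GamLevel_two_le_burauRange ⟨hA.1, reduceMod_ker_le h.two_dvd hA.2⟩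
    · exact Gam_le_burauRange h hA.1
  · let ρ : braidCongruence n ℓ →* GamLevel n ℓ :=
      ((BraidGroup.integralBurau n).comp (braidCongruence n ℓ).subtype).codRestrict
        (GamLevel n ℓ) fun b => ⟨(burauToGam n b).2, b.2⟩
    let N := (GamLevel n (2 * ℓ)).subgroupOf (GamLevel n ℓ)
    let p := (BraidGroup.perm n).comp (braidCongruence n ℓ).subtype
    have hp : Function.Surjective p := perm_restrict_surjective hℓ
    -- One direction lets `ρ` descend along `p`; the other makes the descended map injective.
    have hker : ∀ b, p b = 1 ↔ ρ b ∈ N := by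
      intro b
      have h1 := reduceMod_two_integralBurau_eq_iff (b : BraidGroup n) 1
      rw [map_one, map_one, map_one] at h1
      refine h1.symm.trans ⟨fun h => ?_, fun h => ?_⟩
      · exact ⟨(ρ b).2.1, ker_two_inf_ker hℓ h (ρ b).2.2⟩
      · exact reduceMod_ker_le (Dvd.intro ℓ rfl) h.2
    let ι := p.liftOfSurjective hp ⟨(QuotientGroup.mk' N).comp ρ, fun b hb => by
      rw [MonoidHom.mem_ker, MonoidHom.comp_apply, QuotientGroup.mk'_apply,
        QuotientGroup.eq_one_iff]
      exact (hker b).1 hb⟩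
    have hι : ∀ b, ι (p b) = QuotientGroup.mk (ρ b) := fun b =>
      MonoidHom.liftOfRightInverse_comp_apply _ _ _ _ b
    refine ⟨ι, ?_, fun b => ?_, ?_⟩
    · rw [injective_iff_map_eq_one]
      intro s hs
      obtain ⟨b, rfl⟩ := hp s
      rw [hι, QuotientGroup.eq_one_iff] at hs
      exact (hker b).2 hs
    -- `ι` is computed from a braid `c` of level `ℓ` with the permutation of `b`; the two matrices
    -- agree modulo 2.
    · obtain ⟨c, hc⟩ := hp (BraidGroup.perm n b)
      rw [← hc, hι]
      change QuotientGroup.mk (burauToGam n c) = QuotientGroup.mk (burauToGam n b)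
      rw [QuotientGroup.eq]
      refine ⟨((burauToGam n c)⁻¹ * burauToGam n b).2, ?_⟩
      refine MonoidHom.mem_ker.2 ?_
      change reduceMod n 2 ((BraidGroup.integralBurau n c)⁻¹ * BraidGroup.integralBurau n b) = 1
      rw [map_mul, map_inv, (reduceMod_two_integralBurau_eq_iff (c : BraidGroup n) b).2 hc,
        inv_mul_cancel]
    · ext A
      constructor
      · rintro ⟨⟨b, rfl⟩, hb⟩
        exact ⟨ρ ⟨b, hb⟩, ⟨p ⟨b, hb⟩, hι _⟩, rfl⟩
      · rintro ⟨A, ⟨s, hs⟩, rfl⟩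
        obtain ⟨b, rfl⟩ := hp s
        rw [hι, QuotientGroup.mk'_apply, QuotientGroup.eq] at hs
        refine ⟨?_, A.2.2⟩
        -- `A` differs from a braid matrix by an element of level `2 * ℓ`, hence of level 2.
        have h1 : (ρ b)⁻¹.1 * A.1 ∈ burauRange n := GamLevel_two_le_burauRange
          ⟨((ρ b)⁻¹ * A).2.1, reduceMod_ker_le (Dvd.intro ℓ rfl) hs.2⟩
        have h2 : (ρ b).1 ∈ burauRange n := ⟨b, rfl⟩
        simpa using mul_mem h2 h1
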